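/- **Setting.** Products of Euclidean spaces carry the Euclidean norm. For $\Omega\subset\mathbb R^N$ and $\bar x\in\Omega$ put $\Pi_\Omega(x)=\{w\in\Omega:\|x-w\|=\mathrm{dist}(x;\Omega)\}$; the (basic, limiting) normal cone is $$N_\Omega(\bar x)=\{v:\ \exists\,x_i\to\bar x,\ w_i\in\Pi_\Omega(x_i),\ \alpha_i\ge0\ \text{ with }\ \alpha_i(x_i-w_i)\to v\},$$ and for $f:\mathbb R^N\to(-\infty,\infty]$ finite at $\bar x$ the (basic) subdifferential is $\partial f(\bar x)=\{v:(v,-1)\in N_{\mathrm{epi} f}(\bar x,f(\bar x))\}$. Let $T>0$, $\varepsilon>0$, $k\in\{1,2,\dots\}$, $h_k=T/k$, $t_j=jh_k$, and $x_*\in\mathbb R^n$ (the initial state). Let $\bar z(\cdot)=(\bar x,\bar y,\bar u,\bar a,\bar b)(\cdot)\in W^{1,2}([0,T],\mathbb R^{3n+m+d})$ be a reference arc, $F_h:\mathbb R^{3n+m+d}\rightrightarrows\mathbb R^n$ an arbitrary multifunction with closed graph, $\varphi:\mathbb R^n\to(-\infty,\infty]$, $l_0:[0,T]\times\mathbb R^{4n+2m+2d}\to(-\infty,\infty]$,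 $f_2:\mathbb R^{d+n}\to\mathbb R^n$, $g_i:\mathbb R^n\to\mathbb R$ $(i=1,\dots,s)$. Problem $(P_k)$ is to minimize over $z=(z_0,\dots,z_k)$, $z_j=(x_j,y_j,u_j,a_j,b_j)$, with $\dot z_j:=(z_{j+1}-z_j)/h_k=(\dot x_j,\dot y_j,\dot u_j,\dot a_j,\dot b_j)$, the cost $$\varphi(x_k)+h_k\sum_{j=0}^{k-1}l_0(t_j,x_j,u_j,a_j,b_j,\dot x_j,\dot u_j,\dot a_j,\dot b_j)+\frac12\sum_{j=0}^{k-1}\int_{t_j}^{t_{j+1}}\|\dot z_j-\dot{\bar z}(t)\|^2dt$$ subject to, for $j=0,\dots,k-1$, $$x_{j+1}\in x_j-h_kF_h(z_j),\qquad y_{j+1}=y_j+h_kf_2(b_j,x_j),\qquad z_0=(x_*,0,\bar u(0),\bar a(0),\bar b(0)),\qquad g_i(x_k-u_k)\ge0\ (i=1,\dots,s),$$ and to the localization constraints $$\|z_j-\bar z(t_j)\|\le\tfrac\varepsilon2\ (j=0,\dots,k-1),\qquad \sum_{j=0}^{k-1}\int_{t_j}^{t_{j+1}}\|\dot z_j-\dot{\bar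 z}(t)\|^2dt\le\tfrac\varepsilon2 .$$ **Theorem 7.1.** Let $\bar z^k=(\bar z_0,\dots,\bar z_k)$ be an optimal solution of $(P_k)$, where $k$ is so large that all localization constraints hold with strict inequality at $\bar z^k$. Write $\dot{\bar z}_j=(\dot{\bar x}_j,\dot{\bar y}_j,\dot{\bar u}_j,\dot{\bar a}_j,\dot{\bar b}_j):=(\bar z_{j+1}-\bar z_j)/h_k$. Suppose that $\varphi$ is Lipschitz around $\bar x_k$; that for $j=0,\dots,k-1$ the function $l_0(t_j,\cdot)$ is Lipschitz around $q_j:=(\bar x_j,\bar u_j,\bar a_j,\bar b_j,\dot{\bar x}_j,\dot{\bar u}_j,\dot{\bar a}_j,\dot{\bar b}_j)$ and $f_2$ is continuously differentiable around $(\bar b_j,\bar x_j)$; and that every $g_i$ is continuously differentiable around $\bar x_k-\bar u_k$. Put $$(\theta^x_j,\theta^y_j,\theta^u_j,\theta^a_j,\theta^b_j)=\int_{t_j}^{t_{j+1}}\big(\dot{\bar z}_j-\dot{\bar z}(t)\big)dt,\qquad \xi^x_j=\nabla_xf_2(\bar b_j,\bar x_j),\qquad \xi^b_j=\nabla_bf_2(\bar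 b_j,\bar x_j).$$ Then there are $\lambda\ge0$, $\alpha\in\mathbb R^s_+$, vectors $p_j=(p^x_j,p^y_j,p^u_j,p^a_j,p^b_j)\in\mathbb R^{3n+m+d}$ $(j=0,\dots,k)$, vectors $p^d_j\in\mathbb R^n$ $(j=1,\dots,k)$, and subgradients $$(w^x_j,w^u_j,w^a_j,w^b_j,v^x_j,v^u_j,v^a_j,v^b_j)\in\partial l_0(t_j,\cdot)(q_j),\quad j=0,\dots,k-1,$$ such that the following hold. * Nontriviality: $\lambda+\|\alpha\|+\sum_{j=0}^{k-1}\|p^x_j\|+\sum_{j=1}^{k}\|p^d_j\|+\|p^y_0\|+\|p^u_0\|+\|p^a_0\|+\|p^b_0\|\ne0$. * Complementary slackness: $\alpha_ig_i(\bar x_k-\bar u_k)=0$ for $i=1,\dots,s$. * Transversality: $-p^x_k\in\lambda\,\partial\varphi(\bar x_k)-\sum_i\alpha_i\nabla g_i(\bar x_k-\bar u_k)$, $\ -p^u_k=\sum_i\alpha_i\nabla g_i(\bar x_k-\bar u_k)$, $\ p^y_k=0$, $p^a_k=0$, $p^b_k=0$. * For $j=0,\dots,k-1$: $\ p^y_{j+1}=\lambda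 h_k^{-1}\theta^y_j+h_k^{-1}p^d_{j+1}$, $\ p^u_{j+1}=\lambda(v^u_j+h_k^{-1}\theta^u_j)$, $\ p^a_{j+1}=\lambda(v^a_j+h_k^{-1}\theta^a_j)$, $\ p^b_{j+1}=\lambda(v^b_j+h_k^{-1}\theta^b_j)$. * Discrete Euler–Lagrange inclusions: for $j=0,\dots,k-1$, $$\Big(\tfrac{p^x_{j+1}-p^x_j}{h_k}-\lambda w^x_j+\tfrac{(\xi^x_j)^*p^d_{j+1}}{h_k},\ \tfrac{p^y_{j+1}-p^y_j}{h_k},\ \tfrac{p^u_{j+1}-p^u_j}{h_k}-\lambda w^u_j,\ \tfrac{p^a_{j+1}-p^a_j}{h_k}-\lambda w^a_j,\ \tfrac{p^b_{j+1}-p^b_j}{h_k}-\lambda w^b_j+\tfrac{(\xi^b_j)^*p^d_{j+1}}{h_k},\ \lambda(v^x_j+h_k^{-1}\theta^x_j)-p^x_{j+1}\Big)$$ $$\in N_{\mathrm{gph}F_h}\Big(\bar x_j,\bar y_j,\bar u_j,\bar a_j,\bar b_j,-\tfrac{\bar x_{j+1}-\bar x_j}{h_k}\Big).$$ -/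

import Mathlib

open Filter Topology MeasureTheory

noncomputable section

namespace DiscreteSweeping

/-! ### Euclidean spaces and their Euclidean products -/

/-- The Euclidean space `ℝⁿ`. -/
abbrev Vec (n : ℕ) : Type := EuclideanSpace ℝ (Fin n)

/-- The product of two spaces with the Euclidean norm `‖(x, y)‖² = ‖x‖² + ‖y‖²`. -/
abbrev EProd (α β : Type) : Type := WithLp 2 (α × β)

/-- The vector `(x, y)` of the Euclidean product. -/
abbrev cat {α β : Type} (x : α) (y : β) : EProd α β := WithLp.toLp 2 (x, y)

infixr:35 " ×ₑ " => EProd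
infixr:30 " ⊠ " => cat

/-! ### Generalized differentiation -/

section Variational

variable {E : Type} [NormedAddCommGroup E] [InnerProductSpace ℝ E]

/-- The projection `Π_Ω(x)` of `x` on `Ω`: the points of `Ω` nearest to `x`. -/
def projSet (Ω : Set E) (x : E) : Set E :=
  {w | w ∈ Ω ∧ ‖x - w‖ = Metric.infDist x Ω}

/-- The basic (limiting, Mordukhovich) normal cone to `Ω` at `xbar`; it is empty if `xbar ∉ Ω`. -/
def normalCone (Ω : Set E) (xbar : E) : Set E :=
  {v | xbar ∈ Ω ∧ ∃ (x w : ℕ → E) (α : ℕ → ℝ),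
    Tendsto x atTop (𝓝 xbar) ∧ (∀ i, w i ∈ projSet Ω (x i)) ∧ (∀ i, 0 ≤ α i) ∧
    Tendsto (fun i => α i • (x i - w i)) atTop (𝓝 v)}

/-- The epigraph of a function with values in `(-∞, ∞]`. -/
def epigraph (f : E → WithTop ℝ) : Set (E ×ₑ ℝ) :=
  {q | f q.fst ≤ (q.snd : WithTop ℝ)}

/-- The basic subdifferential of a function with values in `(-∞, ∞]` at a point: the vectors `v`
with `(v, -1)` normal to the epigraph at `(x, f x)`. It is empty where `f x = ∞`. -/
def subdiff (f : E → WithTop ℝ) (x : E) : Set E :=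
  {v | ∃ r : ℝ, f x = (r : WithTop ℝ) ∧ (v ⊠ (-1 : ℝ)) ∈ normalCone (epigraph f) (x ⊠ r)}

/-- `f` is finite and Lipschitz continuous on a neighborhood of `x`. -/
def LocLipschitzAt (f : E → WithTop ℝ) (x : E) : Prop :=
  ∃ U ∈ 𝓝 x, ∃ (K : NNReal) (ψ : E → ℝ), LipschitzOnWith K ψ U ∧ ∀ y ∈ U, f y = (ψ y : WithTop ℝ)

/-- The graph of a multifunction. -/
def graph {G : Type} (F : E → Set G) : Set (E ×ₑ G) :=
  {q | q.snd ∈ F q.fst}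

/-- `z` belongs to `W^{1,2}([0,T])` and `dz` is (a representative of) its velocity. -/
def IsW12Arc (T : ℝ) (z dz : ℝ → E) : Prop :=
  MemLp dz 2 (volume.restrict (Set.Icc 0 T)) ∧
    ∀ t ∈ Set.Icc 0 T, z t = z 0 + ∫ r in (0 : ℝ)..t, dz r

end Variational

/-! ### The discrete problem -/

/-- The space of the vectors `z = (x, y, u, a, b)`. -/
abbrev State (n m d : ℕ) : Type := Vec n ×ₑ Vec n ×ₑ Vec n ×ₑ Vec m ×ₑ Vec d

/-- The space of the arguments `(x, u, a, b, x', u', a', b')` of the running cost. -/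
abbrev RunSpace (n m d : ℕ) : Type :=
  Vec n ×ₑ Vec n ×ₑ Vec m ×ₑ Vec d ×ₑ Vec n ×ₑ Vec n ×ₑ Vec m ×ₑ Vec d

namespace State

variable {n m d : ℕ}

/-- The `x`-component. -/
def x (z : State n m d) : Vec n := z.fst
/-- The `y`-component. -/
def y (z : State n m d) : Vec n := z.snd.fst
/-- The `u`-component. -/
def u (z : State n m d) : Vec n := z.snd.snd.fst
/-- The `a`-component. -/
def a (z : State n m d) : Vec m := z.snd.snd.snd.fst
/-- The `b`-component. -/
def b (z : State n m d) : Vec d := z.snd.snd.snd.snd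

end State

/-- The data of the discrete problem with `k` steps on `[0,T]`: the localization radius `eps`, the
initial state `x0`, the reference arc `zbar` with its velocity `dzbar`, the velocity mapping `F`,
the terminal cost `phi`, the running cost `l0` (its first argument is the time), the mapping `f2` of
`(b, x)`, and the constraint functions `g`. -/
structure Problem (n m d s : ℕ) where
  k : ℕ
  T : ℝ
  eps : ℝ
  x0 : Vec n
  zbar : ℝ → State n m d
  dzbar : ℝ → State n m d
  F : State n m d → Set (Vec n)
  phi : Vec n → WithTop ℝ
  l0 : ℝ → RunSpace n m d → WithTop ℝ
  f2 : Vec d ×ₑ Vec n → Vec n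
  g : Fin s → Vec n → ℝ

namespace Problem

variable {n m d s : ℕ} (P : Problem n m d s)

/-- The step `T / k`. -/
def h : ℝ := P.T / P.k

/-- The mesh point `t_j = j T / k`. -/
def t (j : ℕ) : ℝ := j * P.h

/-- The decision variables `(z_0, …, z_k)`. -/
abbrev Path : Type := Fin (P.k + 1) → State n m d

/-- The discrete velocity `(z_{j+1} - z_j) / h` for `j = 0, …, k-1`. -/
def vel (z : P.Path) (j : Fin P.k) : State n m d :=
  P.h⁻¹ • (z j.succ - z j.castSucc)

/-- The argument of the running cost at step `j`. -/
def runArg (z : P.Path) (j : Fin P.k) : RunSpace n m d :=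
  (z j.castSucc).x ⊠ (z j.castSucc).u ⊠ (z j.castSucc).a ⊠ (z j.castSucc).b ⊠
    (P.vel z j).x ⊠ (P.vel z j).u ⊠ (P.vel z j).a ⊠ (P.vel z j).b

/-- The squared `L²` distance between the discrete velocities and the velocity of the reference
arc. -/
def velDev (z : P.Path) : ℝ :=
  ∑ j : Fin P.k, ∫ r in (P.t j)..(P.t ((j : ℕ) + 1)), ‖P.vel z j - P.dzbar r‖ ^ 2

/-- The cost functional of the discrete problem. -/
def cost (z : P.Path) : WithTop ℝ :=
  P.phi (z (Fin.last P.k)).x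
    + (P.h : WithTop ℝ) * ∑ j : Fin P.k, P.l0 (P.t j) (P.runArg z j)
    + ((1 / 2 * P.velDev z : ℝ) : WithTop ℝ)

/-- The constraints of the discrete problem. -/
structure Feasible (z : P.Path) : Prop where
  inclusion : ∀ j : Fin P.k, ∃ v ∈ P.F (z j.castSucc),
    (z j.succ).x = (z j.castSucc).x - P.h • v
  integral : ∀ j : Fin P.k,
    (z j.succ).y = (z j.castSucc).y + P.h • P.f2 ((z j.castSucc).b ⊠ (z j.castSucc).x)
  initial : z 0 = (P.x0 ⊠ 0 ⊠ (P.zbar 0).u ⊠ (P.zbar 0).a ⊠ (P.zbar 0).b)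
  endpoint : ∀ i : Fin s, 0 ≤ P.g i ((z (Fin.last P.k)).x - (z (Fin.last P.k)).u)
  local_state : ∀ j : Fin P.k, ‖z j.castSucc - P.zbar (P.t j)‖ ≤ P.eps / 2
  local_vel : P.velDev z ≤ P.eps / 2

/-- `z` is a (global) optimal solution of the discrete problem. -/
def IsOptimal (z : P.Path) : Prop :=
  P.Feasible z ∧ ∀ z' : P.Path, P.Feasible z' → P.cost z ≤ P.cost z'

/-- The vector `(θ^x_j, θ^y_j, θ^u_j, θ^a_j, θ^b_j)`. -/
def theta (z : P.Path) (j : Fin P.k) : State n m d :=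
  ∫ r in (P.t j)..(P.t ((j : ℕ) + 1)), (P.vel z j - P.dzbar r)

/-- The partial Jacobian `∇_x f₂(b_j, x_j)`. -/
def xiX (z : P.Path) (j : Fin P.k) : Vec n →L[ℝ] Vec n :=
  fderiv ℝ (fun x => P.f2 ((z j.castSucc).b ⊠ x)) (z j.castSucc).x

/-- The partial Jacobian `∇_b f₂(b_j, x_j)`. -/
def xiB (z : P.Path) (j : Fin P.k) : Vec d →L[ℝ] Vec n :=
  fderiv ℝ (fun b => P.f2 (b ⊠ (z j.castSucc).x)) (z j.castSucc).b

end Problem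

end DiscreteSweeping

end

open DiscreteSweeping

/-! Since the localization constraints are inactive, the problem is locally an abstract program on
the Euclidean space of paths: a smooth cost plus Lipschitz functions of linear images `A r z`, under
constraints `H j z ∈ C j` with `H j` of class C¹ and `C j` closed. The velocity inclusion asks a
linear image of the path to lie in the graph of `F`; the equation for `y` and the initial condition
use the set `{0}`, the endpoint inequalities the half-line `[0, ∞)`.

The multiplier rule for such programs (`exists_multipliers`) comes straight from the definitions of
the limiting objects, with no sum or chain rule for them. Give each set and each Lipschitz function
its own variable, `q j ∈ C j` and `e r`, and penalize `‖H j z - q j‖²` and `‖A r z - e r‖²`.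
Minimality in `q j` makes `q j` a nearest point to `H j z`, so the penalty gradient is a proximal
normal. Minimality in `e r` makes the other penalty gradient a proximal subgradient, bounded through
the Lipschitz constant. Minimality in `z` is Fermat's rule for a C¹ function. After normalization,
compactness and a passage to the limit give normals, subgradients and multipliers of total size one.

For the discrete problem, `step_pairing` writes each step of the stationarity condition as a pairing
with the state plus a pairing with its increment. The coefficient of the increment is the adjoint
vector at the next mesh point, and summation by parts (`euler_of_stationary`) yields the adjoint
equations and transversality. The Euler–Lagrange vector is then the graph normal divided by the
step. Nontriviality holds because the vanishing of the listed quantities would force every abstract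
multiplier to vanish. -/

namespace DiscreteSweeping

/-! ### Proximal approximation of normals and subgradients. -/

section Variational

variable {E : Type} [NormedAddCommGroup E]

/-- A nearest point among the points of a set close to `qbar` is a nearest point of the whole set,
for points sufficiently close to `qbar`. -/
theorem mem_projSet_of_local {C : Set E} {qbar p q : E} {r : ℝ} (hqbar : qbar ∈ C) (hq : q ∈ C)
    (hr : 0 ≤ r) (hp : ‖p - qbar‖ ≤ r / 2)
    (hmin : ∀ w ∈ C, w ∈ Metric.closedBall qbar r → ‖p - q‖ ≤ ‖p - w‖) : q ∈ projSet C p := by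
  refine ⟨hq, le_antisymm ?_ ?_⟩
  · refine (Metric.le_infDist ⟨q, hq⟩).2 fun w hw => ?_
    rw [dist_eq_norm]
    -- A point outside the ball is farther than `r / 2` from `p`, whereas the competitor `qbar` is
    -- within `r / 2`.
    by_cases hwr : w ∈ Metric.closedBall qbar r
    · exact hmin w hw hwr
    · rw [Metric.mem_closedBall, dist_eq_norm, not_le] at hwr
      have h1 := hmin qbar hqbar (Metric.mem_closedBall_self hr)
      have h2 : ‖w - qbar‖ ≤ ‖p - w‖ + ‖p - qbar‖ := by
        rw [norm_sub_rev p w]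
        simpa using norm_add_le (w - p) (p - qbar)
      linarith
  · rw [← dist_eq_norm]
    exact Metric.infDist_le_dist_of_mem hq

variable [InnerProductSpace ℝ E]

/-- A proximal subgradient `v` gives a proximal normal `(v, -1)` to the epigraph. -/
theorem exists_mem_projSet_epigraph {f : E → WithTop ℝ} {ψ : E → ℝ} {e v : E} {δ σ : ℝ}
    (hδ : 0 < δ) (hfψ : ∀ y ∈ Metric.ball e δ, f y = (ψ y : WithTop ℝ))
    (hv : ∀ y ∈ Metric.ball e δ, ψ e + inner ℝ v (y - e) - σ * ‖y - e‖ ^ 2 ≤ ψ y) :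
    ∃ τ₀ > (0 : ℝ), ∀ τ : ℝ, 0 < τ → τ ≤ τ₀ →
      (e ⊠ ψ e) ∈ projSet (epigraph f) ((e ⊠ ψ e) + τ • (v ⊠ (-1 : ℝ))) := by
  set b : ℝ := ‖(v ⊠ (-1 : ℝ))‖ with hb
  have hb0 : 0 ≤ b := norm_nonneg _
  have hb2 : b ^ 2 = ‖v‖ ^ 2 + 1 := by
    rw [hb, WithLp.prod_norm_sq_eq_of_L2]; simp
  have hmem : (e ⊠ ψ e) ∈ epigraph f := by
    show f e ≤ (ψ e : WithTop ℝ)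
    rw [hfψ e (Metric.mem_ball_self hδ)]
  -- The first bound keeps every closer competitor, which lies within `2 * τ * b` of the base point,
  -- over the ball of radius `δ`. The second gives `2 * τ * σ ≤ 1`, so the quadratic error is
  -- absorbed by the squared distance.
  refine ⟨min (δ / (2 * b + 1)) (1 / (2 * |σ| + 1)), by positivity, fun τ hτ hτ₀ => ?_⟩
  have hτ1 : τ * (2 * b + 1) ≤ δ :=
    (le_div_iff₀ (by positivity)).1 (hτ₀.trans (min_le_left _ _))
  have hτ2 : τ * (2 * |σ| + 1) ≤ 1 :=
    (le_div_iff₀ (by positivity)).1 (hτ₀.trans (min_le_right _ _))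
  have hdist : ‖(e ⊠ ψ e) + τ • (v ⊠ (-1 : ℝ)) - (e ⊠ ψ e)‖ = τ * b := by
    rw [add_sub_cancel_left, norm_smul, Real.norm_of_nonneg hτ.le]
  refine ⟨hmem, le_antisymm ?_ ?_⟩
  swap
  · rw [← dist_eq_norm]; exact Metric.infDist_le_dist_of_mem hmem
  refine (Metric.le_infDist ⟨_, hmem⟩).2 fun w hw => ?_
  rw [dist_eq_norm, hdist]
  by_contra! hlt
  have hwe : ‖w - (e ⊠ ψ e)‖ < 2 * (τ * b) := by
    have := norm_sub_le_norm_sub_add_norm_sub w ((e ⊠ ψ e) + τ • (v ⊠ (-1 : ℝ))) (e ⊠ ψ e)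
    rw [norm_sub_rev w (_ + _), hdist] at this
    linarith
  have hwe1 : ‖w.fst - e‖ ≤ ‖w - (e ⊠ ψ e)‖ := by
    refine (sq_le_sq₀ (norm_nonneg _) (norm_nonneg _)).1 ?_
    rw [WithLp.prod_norm_sq_eq_of_L2 (w - (e ⊠ ψ e))]
    exact le_add_of_nonneg_right (sq_nonneg _)
  have hball : w.fst ∈ Metric.ball e δ := by
    rw [Metric.mem_ball, dist_eq_norm]; nlinarith
  have hρ : ψ w.fst ≤ w.snd := by
    have : f w.fst ≤ (w.snd : WithTop ℝ) := hw
    rw [hfψ _ hball] at this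
    exact_mod_cast this
  have h1 := hv _ hball
  have h2 : ‖(e ⊠ ψ e) + τ • (v ⊠ (-1 : ℝ)) - w‖ ^ 2
      = ‖w.fst - e‖ ^ 2 - 2 * τ * inner ℝ v (w.fst - e) + τ ^ 2 * ‖v‖ ^ 2
        + (ψ e - τ - w.snd) ^ 2 := by
    rw [WithLp.prod_norm_sq_eq_of_L2]
    have : ((e ⊠ ψ e) + τ • (v ⊠ (-1 : ℝ)) - w).fst = τ • v - (w.fst - e) := by
      simp; abel
    rw [this, norm_sub_sq_real, norm_smul, inner_smul_left, Real.norm_of_nonneg hτ.le]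
    have : ((e ⊠ ψ e) + τ • (v ⊠ (-1 : ℝ)) - w).snd = ψ e - τ - w.snd := by
      simp; ring
    rw [this, Real.norm_eq_abs, sq_abs]
    simp; ring
  have h3 : ‖(e ⊠ ψ e) + τ • (v ⊠ (-1 : ℝ)) - w‖ ^ 2 < (τ * b) ^ 2 :=
    pow_lt_pow_left₀ hlt (norm_nonneg _) two_ne_zero
  rw [h2, mul_pow, hb2] at h3
  have h4 : 0 ≤ (1 - 2 * τ * σ) * ‖w.fst - e‖ ^ 2 := by
    refine mul_nonneg ?_ (by positivity)
    nlinarith [le_abs_self σ]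
  -- The terms in `v` cancel, leaving `(1 - 2τσ)‖w.fst - e‖² + (ψ e - w.snd)² < 0`, which is absurd.
  nlinarith [mul_le_mul_of_nonneg_left h1 hτ.le, mul_le_mul_of_nonneg_left hρ hτ.le,
    sq_nonneg (ψ e - w.snd)]

/-- Limits of proximal subgradients belong to the basic subdifferential. -/
theorem mem_subdiff_of_tendsto {f : E → WithTop ℝ} {ψ : E → ℝ} {ebar v : E} {e w : ℕ → E}
    {σ : ℕ → ℝ} {U : Set E} (hU : U ∈ 𝓝 ebar) (hfψ : ∀ y ∈ U, f y = (ψ y : WithTop ℝ))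
    (hψ : ContinuousAt ψ ebar) (he : Tendsto e atTop (𝓝 ebar)) (hw : Tendsto w atTop (𝓝 v))
    (hprox : ∀ i, ∀ᶠ y in 𝓝 (e i), y ∈ U ∧
      ψ (e i) + inner ℝ (w i) (y - e i) - σ i * ‖y - e i‖ ^ 2 ≤ ψ y) :
    v ∈ subdiff f ebar := by
  have h : ∀ i, ∃ τ₀ > (0 : ℝ), ∀ τ : ℝ, 0 < τ → τ ≤ τ₀ → (e i ⊠ ψ (e i)) ∈
      projSet (epigraph f) ((e i ⊠ ψ (e i)) + τ • (w i ⊠ (-1 : ℝ))) := by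
    intro i
    obtain ⟨δ, hδ, hball⟩ := Metric.eventually_nhds_iff_ball.1 (hprox i)
    exact exists_mem_projSet_epigraph hδ (fun y hy => hfψ y (hball y hy).1)
      fun y hy => (hball y hy).2
  choose τ₀ hτ₀ hproj using h
  -- The cap `1 / (i + 1)` makes the projected points converge to the base point of the epigraph;
  -- the multiplier `1 / τ` restores the normal `(w i, -1)` exactly.
  have hτ : ∀ i : ℕ, 0 < min (τ₀ i) (1 / ((i : ℝ) + 1)) := fun i =>
    lt_min (hτ₀ i) (by positivity)
  have hτ0 : Tendsto (fun i : ℕ => min (τ₀ i) (1 / ((i : ℝ) + 1))) atTop (𝓝 0) :=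
    squeeze_zero (fun i => (hτ i).le) (fun i => min_le_right _ _)
      tendsto_one_div_add_atTop_nhds_zero_nat
  have hcat : ∀ {a : ℕ → E} {b : ℕ → ℝ} {a₀ : E} {b₀ : ℝ}, Tendsto a atTop (𝓝 a₀) →
      Tendsto b atTop (𝓝 b₀) → Tendsto (fun i => a i ⊠ b i) atTop (𝓝 (a₀ ⊠ b₀)) :=
    fun ha hb => ((WithLp.prod_continuous_toLp 2 E ℝ).tendsto _).comp (ha.prodMk_nhds hb)
  have hmem := mem_of_mem_nhds hU
  refine ⟨ψ ebar, hfψ _ hmem, ?_, _, _, _, ?_, fun i => hproj i _ (hτ i) (min_le_left _ _),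
    fun i => (inv_pos.2 (hτ i)).le, ?_⟩
  · show f ebar ≤ (ψ ebar : WithTop ℝ)
    rw [hfψ _ hmem]
  · have := (hcat he (hψ.tendsto.comp he)).add (hτ0.smul (hcat hw (tendsto_const_nhds (x := (-1 : ℝ)))))
    simpa using this
  · refine (hcat hw (tendsto_const_nhds (x := (-1 : ℝ)))).congr fun i => ?_
    rw [add_sub_cancel_left, smul_smul, inv_mul_cancel₀ (hτ i).ne', one_smul]

theorem normalCone_smul_mem {Ω : Set E} {x v : E} {c : ℝ} (hc : 0 ≤ c)
    (hv : v ∈ normalCone Ω x) : c • v ∈ normalCone Ω x := by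
  obtain ⟨hx, y, w, α, hy, hw, hα, hlim⟩ := hv
  refine ⟨hx, y, w, fun i => c * α i, hy, hw, fun i => mul_nonneg hc (hα i), ?_⟩
  simpa [mul_smul] using hlim.const_smul c

/-- Normals to the half-line `[0, ∞)`. -/
theorem normalCone_Ici {x v : ℝ} (hv : v ∈ normalCone (Set.Ici (0 : ℝ)) x) :
    v ≤ 0 ∧ v * x = 0 := by
  obtain ⟨hx, y, w, α, hy, hw, hα, hlim⟩ := hv
  -- The residual of projecting onto the half-line is nonpositive and vanishes at points of the
  -- half-line; if `x > 0`, the `y i` are eventually such points.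
  have key : ∀ i, y i - w i ≤ 0 ∧ (0 ≤ y i → y i - w i = 0) := by
    intro i
    obtain ⟨hw0, hwd⟩ := hw i
    have hle : ∀ q : ℝ, 0 ≤ q → |y i - w i| ≤ |y i - q| := by
      intro q hq
      rw [← Real.norm_eq_abs, hwd, ← Real.dist_eq]
      exact Metric.infDist_le_dist_of_mem hq
    have h0 : 0 ≤ y i → y i - w i = 0 := fun h => by simpa using hle (y i) h
    refine ⟨?_, h0⟩
    rcases le_total 0 (y i) with h | h
    · exact (h0 h).le
    · have : 0 ≤ w i := hw0
      linarith
  refine ⟨le_of_tendsto' hlim fun i => ?_, ?_⟩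
  · simpa using mul_nonpos_of_nonneg_of_nonpos (hα i) (key i).1
  · rcases eq_or_lt_of_le (show (0 : ℝ) ≤ x from hx) with h | h
    · rw [← h, mul_zero]
    · have : v = 0 := by
        refine tendsto_nhds_unique hlim (tendsto_const_nhds.congr' ?_)
        filter_upwards [hy.eventually (lt_mem_nhds h)] with i hi
        rw [(key i).2 hi.le, smul_zero]
      rw [this, zero_mul]

end Variational

/-! ### The multiplier rule by penalization and passage to the limit. -/

section MultiplierRule

variable {Z : Type} [NormedAddCommGroup Z] [InnerProductSpace ℝ Z] [FiniteDimensional ℝ Z]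
  {ι κ : Type} [Fintype ι] [Fintype κ]
  {G : ι → Type} [∀ j, NormedAddCommGroup (G j)] [∀ j, InnerProductSpace ℝ (G j)]
  [∀ j, FiniteDimensional ℝ (G j)]
  {E : κ → Type} [∀ r, NormedAddCommGroup (E r)] [∀ r, InnerProductSpace ℝ (E r)]
  [∀ r, FiniteDimensional ℝ (E r)]

/-- Points minimizing the penalized problems on a compact neighborhood converge, along a
subsequence, to the given local minimizer. -/
theorem exists_penalty_minimizers {X : Type} [TopologicalSpace X] [FirstCountableTopology X]
    {K : Set X} (hK : IsCompact K)
    {c₀ pen reg : X → ℝ} (hc₀ : ContinuousOn c₀ K) (hpen : ContinuousOn pen K)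
    (hreg : ContinuousOn reg K) (hpen0 : ∀ p ∈ K, 0 ≤ pen p) (hreg0 : ∀ p ∈ K, 0 ≤ reg p)
    {pbar : X} (hpbar : pbar ∈ K) (hpenbar : pen pbar = 0) (hregbar : reg pbar = 0)
    (hmin : ∀ p ∈ K, pen p = 0 → c₀ pbar ≤ c₀ p)
    (huniq : ∀ p ∈ K, pen p = 0 → reg p = 0 → p = pbar) :
    ∃ (p : ℕ → X) (N : ℕ → ℝ), (∀ i, 0 < N i) ∧ (∀ i, p i ∈ K) ∧ Tendsto p atTop (𝓝 pbar) ∧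
      ∀ i, ∀ p' ∈ K, c₀ (p i) + reg (p i) + N i * pen (p i) ≤ c₀ p' + reg p' + N i * pen p' := by
  have hex : ∀ i : ℕ, ∃ p ∈ K, ∀ p' ∈ K,
      c₀ p + reg p + ((i : ℝ) + 1) * pen p ≤ c₀ p' + reg p' + ((i : ℝ) + 1) * pen p' := by
    intro i
    exact hK.exists_isMinOn ⟨pbar, hpbar⟩
      ((hc₀.add hreg).add (continuousOn_const.mul hpen))
  choose p hpK hpmin using hex
  obtain ⟨phat, hphat, φ, hφ, hlim⟩ := hK.tendsto_subseq hpK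
  have hw : Tendsto (p ∘ φ) atTop (𝓝[K] phat) :=
    tendsto_nhdsWithin_iff.2 ⟨hlim, Eventually.of_forall fun i => hpK _⟩
  have hval : ∀ i, c₀ (p i) + reg (p i) + ((i : ℝ) + 1) * pen (p i) ≤ c₀ pbar := by
    intro i
    simpa [hpenbar, hregbar] using hpmin i pbar hpbar
  obtain ⟨pm, -, hpm⟩ := hK.exists_isMinOn ⟨pbar, hpbar⟩ hc₀
  -- With `c₀` bounded below on `K`, comparison with `pbar` forces the penalty to zero at rate `1 /
  -- (i + 1)`.
  have hpenle : ∀ i : ℕ, pen (p i) ≤ (c₀ pbar - c₀ pm) * (1 / ((i : ℝ) + 1)) := by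
    intro i
    rw [mul_one_div, le_div_iff₀ (by positivity)]
    have h1 : c₀ pm ≤ c₀ (p i) := hpm (hpK i)
    nlinarith [hval i, hreg0 _ (hpK i)]
  have hpenlim : Tendsto (fun i => pen (p i)) atTop (𝓝 0) := by
    refine squeeze_zero (fun i => hpen0 _ (hpK i)) hpenle ?_
    simpa using tendsto_one_div_add_atTop_nhds_zero_nat.const_mul (c₀ pbar - c₀ pm)
  have hpenhat : pen phat = 0 :=
    tendsto_nhds_unique ((hpen phat hphat).tendsto.comp hw) (hpenlim.comp hφ.tendsto_atTop)
  have hle : c₀ phat + reg phat ≤ c₀ pbar := by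
    refine le_of_tendsto' (((hc₀.add hreg) phat hphat).tendsto.comp hw) fun i => ?_
    have h1 := hval (φ i)
    have h2 := hpen0 _ (hpK (φ i))
    have : 0 ≤ ((φ i : ℝ) + 1) * pen (p (φ i)) := by positivity
    simp only [Function.comp, Pi.add_apply]
    linarith
  -- The limit is feasible, hence no better than `pbar`, and the inequality above leaves no room for
  -- the regularizer. This pins the limit at `pbar` even when the minimum is not strict.
  have hreghat : reg phat = 0 :=
    le_antisymm (by linarith [hmin phat hphat hpenhat]) (hreg0 _ hphat)
  obtain rfl := huniq phat hphat hpenhat hreghat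
  exact ⟨p ∘ φ, fun i => (φ i : ℝ) + 1, fun i => by positivity, fun i => hpK _, hlim,
    fun i => hpmin (φ i)⟩

/-- All summands but one are unaffected by the update. This decouples joint minimality in the
auxiliary variables into minimality in each of them. -/
theorem le_of_sum_le_sum_update {κ : Type} [Fintype κ] [DecidableEq κ] {E : κ → Type}
    {F : ∀ r, E r → ℝ} {e : ∀ r, E r} {r : κ} {y : E r}
    (h : ∑ r', F r' (e r') ≤ ∑ r', F r' (Function.update e r y r')) : F r (e r) ≤ F r y := by
  rw [← Finset.add_sum_erase _ _ (Finset.mem_univ r),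
    ← Finset.add_sum_erase _ _ (Finset.mem_univ r), Function.update_self] at h
  have : ∑ r' ∈ Finset.univ.erase r, F r' (Function.update e r y r')
      = ∑ r' ∈ Finset.univ.erase r, F r' (e r') :=
    Finset.sum_congr rfl fun r' hr' => by rw [Function.update_of_ne (Finset.ne_of_mem_erase hr')]
  linarith

/-- The approximate multipliers of the penalized problems. -/
theorem exists_approximate_multipliers
    {C : ∀ j, Set (G j)} (hC : ∀ j, IsClosed (C j)) {H : ∀ j, Z → G j}
    {A : ∀ r, Z →L[ℝ] E r} {c : κ → ℝ} (hc : ∀ r, 0 < c r) {ψ : ∀ r, E r → ℝ} {s : Z → ℝ}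
    {zbar : Z} (hmem : ∀ j, H j zbar ∈ C j) (hH : ∀ j, ContDiffAt ℝ 1 (H j) zbar)
    (hs : ContDiffAt ℝ 1 s zbar) {L : κ → NNReal} {U : ∀ r, Set (E r)}
    (hU : ∀ r, U r ∈ 𝓝 (A r zbar)) (hψ : ∀ r, LipschitzOnWith (L r) (ψ r) (U r))
    (hmin : ∀ᶠ z in 𝓝 zbar, (∀ j, H j z ∈ C j) →
      s zbar + ∑ r, c r * ψ r (A r zbar) ≤ s z + ∑ r, c r * ψ r (A r z)) :
    ∃ (z : ℕ → Z) (q : ℕ → ∀ j, G j) (e v : ℕ → ∀ r, E r) (N : ℕ → ℝ),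
      Tendsto z atTop (𝓝 zbar) ∧ (∀ r, Tendsto (fun i => e i r) atTop (𝓝 (A r zbar))) ∧
      (∀ i, 0 < N i) ∧ (∀ i j, q i j ∈ projSet (C j) (H j (z i))) ∧
      (∀ i r, ‖v i r‖ ≤ 2 * L r) ∧
      (∀ i r, ∀ᶠ y in 𝓝 (e i r), y ∈ U r ∧
        ψ r (e i r) + inner ℝ (v i r) (y - e i r) - N i / c r * ‖y - e i r‖ ^ 2 ≤ ψ r y) ∧
      ∀ i δ, fderiv ℝ s (z i) δ + inner ℝ (z i - zbar) δ + ∑ r, c r * inner ℝ (v i r) (A r δ)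
        + ∑ j, N i * inner ℝ (H j (z i) - q i j) (fderiv ℝ (H j) (z i) δ) = 0 := by
  classical
  have hev : ∀ᶠ z in 𝓝 zbar, (∀ j, ContDiffAt ℝ 1 (H j) z) ∧ ContDiffAt ℝ 1 s z ∧
      (∀ r, A r z ∈ U r) ∧ ((∀ j, H j z ∈ C j) →
        s zbar + ∑ r, c r * ψ r (A r zbar) ≤ s z + ∑ r, c r * ψ r (A r z)) := by
    refine (eventually_all.2 fun j => (hH j).eventually (by simp)).and
      ((hs.eventually (by simp)).and ((eventually_all.2 fun r => ?_).and hmin))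
    exact (A r).continuous.continuousAt.eventually (hU r)
  obtain ⟨ρ₁, hρ₁, hball₁⟩ := Metric.eventually_nhds_iff_ball.1 hev
  have hex : ∀ r, ∃ ε > 0, Metric.ball (A r zbar) ε ⊆ U r := fun r =>
    Metric.mem_nhds_iff.1 (hU r)
  choose ε hε hεU using hex
  obtain ⟨ρ, hρ, hρ₁', hρε⟩ : ∃ ρ > 0, ρ < ρ₁ ∧ ∀ r, ρ < ε r := by
    have : ∀ᶠ ρ : ℝ in 𝓝[>] 0, ρ < ρ₁ ∧ ∀ r, ρ < ε r :=
      ((eventually_lt_nhds hρ₁).filter_mono nhdsWithin_le_nhds).and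
        (eventually_all.2 fun r => (eventually_lt_nhds (hε r)).filter_mono nhdsWithin_le_nhds)
    obtain ⟨ρ, h1, h2⟩ := (this.and self_mem_nhdsWithin).exists
    exact ⟨ρ, h2, h1⟩
  have hball : ∀ z ∈ Metric.closedBall zbar ρ, _ := fun z hz =>
    hball₁ z (Metric.closedBall_subset_ball hρ₁' hz)
  have hUball : ∀ r, Metric.closedBall (A r zbar) ρ ⊆ U r := fun r =>
    (Metric.closedBall_subset_ball (hρε r)).trans (hεU r)
  -- The components are `z`, a point `q j` of each set `C j`, and a copy `e r` of each argument `A r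
  -- z`; only the penalty ties them together.
  let K : Set (Z × (∀ j, G j) × (∀ r, E r)) :=
    Metric.closedBall zbar ρ ×ˢ
      ((Set.univ.pi fun j => C j ∩ Metric.closedBall (H j zbar) ρ) ×ˢ
        (Set.univ.pi fun r => Metric.closedBall (A r zbar) ρ))
  have hKz : ∀ p ∈ K, p.1 ∈ Metric.closedBall zbar ρ := fun p hp => hp.1
  have hKq : ∀ p ∈ K, ∀ j, p.2.1 j ∈ C j ∩ Metric.closedBall (H j zbar) ρ :=
    fun p hp j => hp.2.1 j trivial
  have hKe : ∀ p ∈ K, ∀ r, p.2.2 r ∈ Metric.closedBall (A r zbar) ρ :=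
    fun p hp r => hp.2.2 r trivial
  have hK : IsCompact K := (isCompact_closedBall _ _).prod
    ((isCompact_univ_pi fun j => (isCompact_closedBall _ _).inter_left (hC j)).prod
      (isCompact_univ_pi fun r => isCompact_closedBall _ _))
  have hH' : ∀ j, ContinuousOn (fun p : Z × (∀ j, G j) × (∀ r, E r) => H j p.1) K := fun j p hp =>
    ContinuousAt.comp_continuousWithinAt (f := Prod.fst) (g := H j)
      ((hball p.1 hp.1).1 j).continuousAt continuousWithinAt_fst
  have hc₀ : ContinuousOn (fun p : Z × (∀ j, G j) × (∀ r, E r) =>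
      s p.1 + ∑ r, c r * ψ r (p.2.2 r)) K := by
    refine ContinuousOn.add (fun p hp => ?_) (continuousOn_finsetSum _ fun r _ =>
      continuousOn_const.mul ((hψ r).continuousOn.comp (by fun_prop)
        fun p hp => hUball r (hKe p hp r)))
    exact ContinuousAt.comp_continuousWithinAt (f := Prod.fst) (g := s)
      (hball p.1 hp.1).2.1.continuousAt continuousWithinAt_fst
  have hpen : ContinuousOn (fun p : Z × (∀ j, G j) × (∀ r, E r) =>
      1 / 2 * (∑ r, ‖A r p.1 - p.2.2 r‖ ^ 2 + ∑ j, ‖H j p.1 - p.2.1 j‖ ^ 2)) K := by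
    refine continuousOn_const.mul (ContinuousOn.add ?_ (continuousOn_finsetSum _ fun j _ =>
      (((hH' j).sub (by fun_prop)).norm.pow 2)))
    exact Continuous.continuousOn (by fun_prop)
  have hpen_eq : ∀ p : Z × (∀ j, G j) × (∀ r, E r),
      1 / 2 * (∑ r, ‖A r p.1 - p.2.2 r‖ ^ 2 + ∑ j, ‖H j p.1 - p.2.1 j‖ ^ 2) = 0 →
      (∀ r, A r p.1 = p.2.2 r) ∧ ∀ j, H j p.1 = p.2.1 j := by
    intro p hp
    have h1 : 0 ≤ ∑ r, ‖A r p.1 - p.2.2 r‖ ^ 2 := by positivity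
    have h2 : 0 ≤ ∑ j, ‖H j p.1 - p.2.1 j‖ ^ 2 := by positivity
    have h3 : ∑ r, ‖A r p.1 - p.2.2 r‖ ^ 2 = 0 := by linarith
    have h4 : ∑ j, ‖H j p.1 - p.2.1 j‖ ^ 2 = 0 := by linarith
    rw [Finset.sum_eq_zero_iff_of_nonneg (fun _ _ => by positivity)] at h3 h4
    refine ⟨fun r => ?_, fun j => ?_⟩
    · simpa [sub_eq_zero] using h3 r (Finset.mem_univ r)
    · simpa [sub_eq_zero] using h4 j (Finset.mem_univ j)
  obtain ⟨p, N, hN, hpK, hplim, hpmin⟩ := exists_penalty_minimizers hK hc₀ hpen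
    (reg := fun p => 1 / 2 * ‖p.1 - zbar‖ ^ 2) (Continuous.continuousOn (by fun_prop))
    (fun p _ => by positivity) (fun p _ => by positivity)
    (pbar := (zbar, fun j => H j zbar, fun r => A r zbar))
    ⟨Metric.mem_closedBall_self hρ.le,
      fun j _ => ⟨hmem j, Metric.mem_closedBall_self hρ.le⟩,
      fun r _ => Metric.mem_closedBall_self hρ.le⟩ (by simp) (by simp)
    (fun p hp h0 => by
      obtain ⟨h1, h2⟩ := hpen_eq p h0
      have := (hball p.1 (hKz p hp)).2.2.2 fun j => h2 j ▸ (hKq p hp j).1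
      simpa only [h1] using this)
    (fun p hp h0 h1 => by
      obtain ⟨h2, h3⟩ := hpen_eq p h0
      have h4 : p.1 = zbar := by simpa [sub_eq_zero] using h1
      refine Prod.ext h4 (Prod.ext ?_ ?_)
      · funext j; rw [← h3 j, h4]
      · funext r; rw [← h2 r, h4])
  have hzlim : Tendsto (fun i => (p i).1) atTop (𝓝 zbar) :=
    (continuous_fst.tendsto _).comp hplim
  have helim : ∀ r, Tendsto (fun i => (p i).2.2 r) atTop (𝓝 (A r zbar)) := fun r =>
    (((continuous_apply r).comp (continuous_snd.comp continuous_snd)).tendsto _).comp hplim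
  have hgood : ∀ᶠ i in atTop, (p i).1 ∈ Metric.ball zbar ρ ∧
      (∀ j, ‖H j (p i).1 - H j zbar‖ ≤ ρ / 2) ∧
      (∀ r, (p i).2.2 r ∈ Metric.ball (A r zbar) ρ) ∧
      ∀ r, A r (p i).1 ∈ Metric.ball (A r zbar) ρ := by
    refine (hzlim.eventually (Metric.ball_mem_nhds _ hρ)).and
      ((eventually_all.2 fun j => ?_).and ((eventually_all.2 fun r =>
        (helim r).eventually (Metric.ball_mem_nhds _ hρ)).and (eventually_all.2 fun r =>
        (((A r).continuous.tendsto _).comp hzlim).eventually (Metric.ball_mem_nhds _ hρ))))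
    have : Tendsto (fun i => ‖H j (p i).1 - H j zbar‖) atTop (𝓝 0) := by
      simpa using (((hH j).continuousAt.tendsto.comp hzlim).sub_const (H j zbar)).norm
    exact (this.eventually (gt_mem_nhds (half_pos hρ))).mono fun i hi => hi.le
  -- Dropping the first `i₀` terms puts `z` and every `e r` in the interior of its ball for all
  -- remaining indices.
  obtain ⟨i₀, hi₀⟩ := eventually_atTop.1 hgood
  have hgood' : ∀ i, _ := fun i => hi₀ (i + i₀) (Nat.le_add_left _ _)
  have hqmin : ∀ i j, ∀ w ∈ C j, w ∈ Metric.closedBall (H j zbar) ρ →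
      ‖H j (p i).1 - (p i).2.1 j‖ ≤ ‖H j (p i).1 - w‖ := by
    intro i j w hw hwρ
    have h := hpmin i ((p i).1, Function.update (p i).2.1 j w, (p i).2.2)
      ⟨(hpK i).1, fun j' _ => by
        by_cases hj : j' = j
        · subst hj; simpa using ⟨hw, hwρ⟩
        · simpa [Function.update_of_ne hj] using hKq _ (hpK i) j', fun r _ => hKe _ (hpK i) r⟩
    have h' := le_of_sum_le_sum_update (F := fun j w => ‖H j (p i).1 - w‖ ^ 2)
      (e := (p i).2.1) (r := j) (y := w) (by
        have := hN i
        dsimp only at h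
        have h5 := le_of_mul_le_mul_left (le_of_add_le_add_left h) this
        linarith)
    exact (sq_le_sq₀ (norm_nonneg _) (norm_nonneg _)).1 h'
  have hemin : ∀ i r, ∀ y ∈ Metric.closedBall (A r zbar) ρ,
      c r * ψ r ((p i).2.2 r) + N i / 2 * ‖A r (p i).1 - (p i).2.2 r‖ ^ 2 ≤
        c r * ψ r y + N i / 2 * ‖A r (p i).1 - y‖ ^ 2 := by
    intro i r y hy
    have h := hpmin i ((p i).1, (p i).2.1, Function.update (p i).2.2 r y)
      ⟨(hpK i).1, fun j _ => hKq _ (hpK i) j, fun r' _ => by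
        by_cases hr : r' = r
        · subst hr; simpa using hy
        · simpa [Function.update_of_ne hr] using hKe _ (hpK i) r'⟩
    refine le_of_sum_le_sum_update
      (F := fun r y => c r * ψ r y + N i / 2 * ‖A r (p i).1 - y‖ ^ 2)
      (e := (p i).2.2) (r := r) (y := y) ?_
    simp only [Finset.sum_add_distrib, ← Finset.mul_sum]
    dsimp only at h
    linarith
  -- The subgradient `(N / c r) • (A r z - e r)` is what balances the penalty gradient in `e r`
  -- against the weight `c r`.
  refine ⟨fun i => (p (i + i₀)).1, fun i => (p (i + i₀)).2.1, fun i => (p (i + i₀)).2.2,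
    fun i r => (N (i + i₀) / c r) • (A r (p (i + i₀)).1 - (p (i + i₀)).2.2 r),
    fun i => N (i + i₀), hzlim.comp (tendsto_add_atTop_nat i₀),
    fun r => (helim r).comp (tendsto_add_atTop_nat i₀), fun i => hN _, fun i j => ?_,
    fun i r => ?_, fun i r => ?_, fun i δ => ?_⟩
  · exact mem_projSet_of_local (hmem j) (hKq _ (hpK _) j).1 hρ.le ((hgood' i).2.1 j)
      (hqmin _ j)
  -- Testing minimality with `y = A r z` gives `N / 2 * ‖A r z - e r‖² ≤ c r * L r * ‖A r z - e r‖`,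
  -- hence the bound `2 * L r`, whatever the size of `N`.
  · have h1 := hemin (i + i₀) r _ (Metric.ball_subset_closedBall ((hgood' i).2.2.2 r))
    have h2 := (hψ r).dist_le_mul _
      (hUball r (Metric.ball_subset_closedBall ((hgood' i).2.2.2 r))) _
      (hUball r (hKe _ (hpK (i + i₀)) r))
    have h3 := hN (i + i₀)
    have h4 := hc r
    rw [Real.dist_eq, dist_eq_norm] at h2
    have h5 := (le_abs_self _).trans h2
    rw [norm_smul, Real.norm_of_nonneg (by positivity), div_mul_eq_mul_div, div_le_iff₀ h4]
    set x := ‖A r (p (i + i₀)).1 - (p (i + i₀)).2.2 r‖ with hx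
    rcases (norm_nonneg (A r (p (i + i₀)).1 - (p (i + i₀)).2.2 r)).eq_or_lt with h0 | h0
    · rw [← hx] at h0
      rw [← h0]
      simp; positivity
    · rw [← hx] at h0
      refine le_of_mul_le_mul_right ?_ h0
      simp only [sub_self, norm_zero] at h1
      nlinarith [mul_le_mul_of_nonneg_left h5 h4.le]
  · have hnhds := (Metric.isOpen_ball (x := A r zbar) (ε := ρ)).mem_nhds ((hgood' i).2.2.1 r)
    filter_upwards [hnhds] with y hy
    have hy' := Metric.ball_subset_closedBall hy
    refine ⟨hUball r hy', ?_⟩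
    have h1 := hemin (i + i₀) r y hy'
    have h3 := hN (i + i₀)
    have h4 := hc r
    -- Expanding the square about `e r` yields the proximal inequality with coefficient `N / (2 * c
    -- r)`; the claimed `N / c r` is weaker.
    have h5 : ‖A r (p (i + i₀)).1 - y‖ ^ 2 = ‖A r (p (i + i₀)).1 - (p (i + i₀)).2.2 r‖ ^ 2
        - 2 * inner ℝ (A r (p (i + i₀)).1 - (p (i + i₀)).2.2 r) (y - (p (i + i₀)).2.2 r)
        + ‖y - (p (i + i₀)).2.2 r‖ ^ 2 := by
      rw [← norm_sub_sq_real]; congr 2; abel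
    rw [h5] at h1
    refine le_of_mul_le_mul_left ?_ h4
    rw [real_inner_smul_left, mul_sub, mul_add, ← mul_assoc, ← mul_assoc,
      mul_div_cancel₀ _ h4.ne']
    nlinarith [mul_nonneg h3.le (sq_nonneg ‖y - (p (i + i₀)).2.2 r‖)]
  · have hgi := hgood' i
    dsimp only
    generalize i + i₀ = i' at hgi ⊢
    have hz := hball _ (hKz _ (hpK i'))
    -- With `q` and `e` frozen, the nonsmooth terms are constant in `z`, so Fermat's rule applies to
    -- a differentiable function.
    have hloc : IsLocalMin (fun z => s z + 1 / 2 * ‖z - zbar‖ ^ 2 + N i' * (1 / 2 *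
        (∑ r, ‖A r z - (p i').2.2 r‖ ^ 2 + ∑ j, ‖H j z - (p i').2.1 j‖ ^ 2))) (p i').1 := by
      have := Metric.isOpen_ball.mem_nhds hgi.1
      filter_upwards [this] with z hz
      have := hpmin i' (z, (p i').2.1, (p i').2.2)
        ⟨Metric.ball_subset_closedBall hz, (hpK i').2⟩
      dsimp only at this
      linarith
    have hd := (((hz.2.1.differentiableAt one_ne_zero).hasFDerivAt).add
      ((((hasFDerivAt_id (p i').1).sub_const zbar).norm_sq).const_mul (1 / 2))).add
      ((((HasFDerivAt.fun_sum (u := Finset.univ) fun r _ =>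
        (((A r).hasFDerivAt (x := (p i').1)).sub_const ((p i').2.2 r)).norm_sq)).add
      (HasFDerivAt.fun_sum (u := Finset.univ) fun j _ =>
        ((((hz.1 j).differentiableAt one_ne_zero).hasFDerivAt).sub_const
          ((p i').2.1 j)).norm_sq)).const_mul (1 / 2) |>.const_mul (N i'))
    have h0 := DFunLike.congr_fun (hloc.hasFDerivAt_eq_zero hd) δ
    simp [sum_apply] at h0
    simp only [real_inner_smul_left]
    have e1 : ∀ r, c r * (N i' / c r * inner ℝ (A r (p i').1 - (p i').2.2 r) (A r δ))
        = N i' * inner ℝ (A r (p i').1 - (p i').2.2 r) (A r δ) := fun r => by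
      rw [← mul_assoc, mul_div_cancel₀ _ (hc r).ne']
    simp only [e1]
    simp only [← Finset.mul_sum, inner_sub_left]
    simp only [← Finset.mul_sum] at h0
    linarith

/-- **Lagrange multiplier rule** for the minimization of a smooth function plus a weighted sum of
Lipschitz functions under smooth constraints `H j z ∈ C j` with closed sets `C j`. -/
theorem exists_multipliers
    {C : ∀ j, Set (G j)} (hC : ∀ j, IsClosed (C j)) {H : ∀ j, Z → G j}
    {A : ∀ r, Z →L[ℝ] E r} {c : κ → ℝ} (hc : ∀ r, 0 < c r) {f : ∀ r, E r → WithTop ℝ}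
    {ψ : ∀ r, E r → ℝ} {s : Z → ℝ}
    {zbar : Z} (hmem : ∀ j, H j zbar ∈ C j) (hH : ∀ j, ContDiffAt ℝ 1 (H j) zbar)
    (hs : ContDiffAt ℝ 1 s zbar) {L : κ → NNReal} {U : ∀ r, Set (E r)}
    (hU : ∀ r, U r ∈ 𝓝 (A r zbar)) (hψ : ∀ r, LipschitzOnWith (L r) (ψ r) (U r))
    (hfψ : ∀ r, ∀ y ∈ U r, f r y = (ψ r y : WithTop ℝ))
    (hmin : ∀ᶠ z in 𝓝 zbar, (∀ j, H j z ∈ C j) →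
      s zbar + ∑ r, c r * ψ r (A r zbar) ≤ s z + ∑ r, c r * ψ r (A r z)) :
    ∃ (lam : ℝ) (η : ∀ j, G j) (ν : ∀ r, E r), 0 ≤ lam ∧
      (∀ j, η j ∈ normalCone (C j) (H j zbar)) ∧ (∀ r, ν r ∈ subdiff (f r) (A r zbar)) ∧
      lam + ∑ j, ‖η j‖ = 1 ∧
      ∀ δ, lam * (fderiv ℝ s zbar δ + ∑ r, c r * inner ℝ (ν r) (A r δ))
        + ∑ j, inner ℝ (η j) (fderiv ℝ (H j) zbar δ) = 0 := by
  obtain ⟨z, q, e, v, N, hz, he, hN, hq, hv, hprox, hstat⟩ :=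
    exists_approximate_multipliers hC hc hmem hH hs hU hψ hmin
  -- Dividing by `M` makes the cost multiplier `1 / M` and the norms of the normals sum to one. The
  -- subgradients are already bounded and are not rescaled.
  set M : ℕ → ℝ := fun i => 1 + ∑ j, N i * ‖H j (z i) - q i j‖ with hM
  have hterm : ∀ i j, 0 ≤ N i * ‖H j (z i) - q i j‖ := fun i j =>
    mul_nonneg (hN i).le (norm_nonneg _)
  have hM1 : ∀ i, 1 ≤ M i := fun i =>
    le_add_of_nonneg_right (Finset.sum_nonneg fun j _ => hterm i j)
  have hM0 : ∀ i, 0 < M i := fun i => one_pos.trans_le (hM1 i)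
  set η : ℕ → ∀ j, G j := fun i j => (N i / M i) • (H j (z i) - q i j) with hη
  have hηnorm : ∀ i j, ‖η i j‖ = N i * ‖H j (z i) - q i j‖ / M i := fun i j => by
    rw [hη, norm_smul, Real.norm_of_nonneg (div_nonneg (hN i).le (hM0 i).le)]; ring
  have hsum : ∀ i, (M i)⁻¹ + ∑ j, ‖η i j‖ = 1 := fun i => by
    simp only [hηnorm, ← Finset.sum_div]
    rw [inv_eq_one_div, ← add_div]
    exact div_self (hM0 i).ne'
  have hη1 : ∀ i j, ‖η i j‖ ≤ 1 := fun i j => by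
    have h1 := Finset.single_le_sum (f := fun j => ‖η i j‖) (fun j _ => norm_nonneg _)
      (Finset.mem_univ j)
    have h2 := inv_nonneg.2 (hM0 i).le
    have h3 := hsum i
    linarith
  have hK : IsCompact (Set.Icc (0 : ℝ) 1 ×ˢ
      ((Set.univ.pi fun j => Metric.closedBall (0 : G j) 1) ×ˢ
        (Set.univ.pi fun r => Metric.closedBall (0 : E r) (2 * L r)))) :=
    isCompact_Icc.prod ((isCompact_univ_pi fun j => isCompact_closedBall _ _).prod
      (isCompact_univ_pi fun r => isCompact_closedBall _ _))
  obtain ⟨⟨lam, ηb, ν⟩, hmemK, φ, hφ, hlim⟩ := hK.tendsto_subseq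
    (x := fun i => ((M i)⁻¹, η i, v i)) fun i =>
      ⟨⟨inv_nonneg.2 (hM0 i).le, inv_le_one_of_one_le₀ (hM1 i)⟩,
        fun j _ => by simpa using hη1 i j, fun r _ => by simpa using hv i r⟩
  have hφ' := hφ.tendsto_atTop
  have hlam : Tendsto (fun i => (M (φ i))⁻¹) atTop (𝓝 lam) := (continuous_fst.tendsto _).comp hlim
  have hηlim : ∀ j, Tendsto (fun i => η (φ i) j) atTop (𝓝 (ηb j)) := fun j =>
    (((continuous_apply j).comp (continuous_fst.comp continuous_snd)).tendsto _).comp hlim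
  have hνlim : ∀ r, Tendsto (fun i => v (φ i) r) atTop (𝓝 (ν r)) := fun r =>
    (((continuous_apply r).comp (continuous_snd.comp continuous_snd)).tendsto _).comp hlim
  have hz' := hz.comp hφ'
  have hfd : ∀ {W : Type} [NormedAddCommGroup W] [NormedSpace ℝ W] {h : Z → W},
      ContDiffAt ℝ 1 h zbar → ∀ δ, Tendsto (fun i => fderiv ℝ h (z (φ i)) δ) atTop
        (𝓝 (fderiv ℝ h zbar δ)) := fun hh δ =>
    (((hh.fderiv_right (m := 0) le_rfl).continuousAt.clm_apply
      continuousAt_const).tendsto).comp hz'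
  refine ⟨lam, ηb, ν, hmemK.1.1, fun j => ?_, fun r => ?_, ?_, fun δ => ?_⟩
  · exact ⟨hmem j, fun i => H j (z (φ i)), fun i => q (φ i) j, fun i => N (φ i) / M (φ i),
      (hH j).continuousAt.tendsto.comp hz', fun i => hq _ _,
      fun i => div_nonneg (hN _).le (hM0 _).le, hηlim j⟩
  · exact mem_subdiff_of_tendsto (hU r) (hfψ r) ((hψ r).continuousOn.continuousAt (hU r))
      ((he r).comp hφ') (hνlim r) fun i => hprox _ r
  · refine tendsto_nhds_unique (hlam.add (tendsto_finsetSum _ fun j _ => (hηlim j).norm)) ?_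
    exact tendsto_const_nhds.congr fun i => (hsum (φ i)).symm
  -- The contribution `z - zbar` of the regularizer vanishes in the limit.
  · have h1 : Tendsto (fun i => (M (φ i))⁻¹ * (fderiv ℝ s (z (φ i)) δ
        + inner ℝ (z (φ i) - zbar) δ + ∑ r, c r * inner ℝ (v (φ i) r) (A r δ))
        + ∑ j, inner ℝ (η (φ i) j) (fderiv ℝ (H j) (z (φ i)) δ)) atTop
        (𝓝 (lam * (fderiv ℝ s zbar δ + inner ℝ (zbar - zbar) δ
          + ∑ r, c r * inner ℝ (ν r) (A r δ)) + ∑ j, inner ℝ (ηb j) (fderiv ℝ (H j) zbar δ))) :=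
      (hlam.mul (((hfd hs δ).add ((hz'.sub_const zbar).inner tendsto_const_nhds)).add
        (tendsto_finsetSum _ fun r _ => ((hνlim r).inner tendsto_const_nhds).const_mul _))).add
        (tendsto_finsetSum _ fun j _ => (hηlim j).inner (hfd (hH j) δ))
    have h2 : ∀ i, (M i)⁻¹ * (fderiv ℝ s (z i) δ
        + inner ℝ (z i - zbar) δ + ∑ r, c r * inner ℝ (v i r) (A r δ))
        + ∑ j, inner ℝ (η i j) (fderiv ℝ (H j) (z i) δ) = 0 := fun i => by
      have := congrArg ((M i)⁻¹ * ·) (hstat i δ)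
      simp only [mul_zero, mul_add _ _ (∑ j, N i * _), Finset.mul_sum Finset.univ
        (fun j => N i * _)] at this
      rw [← this]
      congr 1
      refine Finset.sum_congr rfl fun j _ => ?_
      rw [hη, real_inner_smul_left]
      ring
    have := tendsto_nhds_unique h1 (tendsto_const_nhds.congr fun i => (h2 (φ i)).symm)
    simpa using this

end MultiplierRule

/-! ### Families of inner product spaces indexed by a sum type. -/

section SumFamily

variable {ι₁ ι₂ : Type} {G₁ : ι₁ → Type} {G₂ : ι₂ → Type}

instance instNormedAddCommGroupSumElim [∀ i, NormedAddCommGroup (G₁ i)]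
    [∀ i, NormedAddCommGroup (G₂ i)] (i : ι₁ ⊕ ι₂) : NormedAddCommGroup (Sum.elim G₁ G₂ i) :=
  match i with
  | .inl i => inferInstanceAs (NormedAddCommGroup (G₁ i))
  | .inr i => inferInstanceAs (NormedAddCommGroup (G₂ i))

variable [∀ i, NormedAddCommGroup (G₁ i)] [∀ i, NormedAddCommGroup (G₂ i)]
  [∀ i, InnerProductSpace ℝ (G₁ i)] [∀ i, InnerProductSpace ℝ (G₂ i)]

instance instInnerProductSpaceSumElim (i : ι₁ ⊕ ι₂) :
    InnerProductSpace ℝ (Sum.elim G₁ G₂ i) :=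
  match i with
  | .inl i => inferInstanceAs (InnerProductSpace ℝ (G₁ i))
  | .inr i => inferInstanceAs (InnerProductSpace ℝ (G₂ i))

instance instFiniteDimensionalSumElim [∀ i, FiniteDimensional ℝ (G₁ i)]
    [∀ i, FiniteDimensional ℝ (G₂ i)] (i : ι₁ ⊕ ι₂) :
    FiniteDimensional ℝ (Sum.elim G₁ G₂ i) :=
  match i with
  | .inl i => inferInstanceAs (FiniteDimensional ℝ (G₁ i))
  | .inr i => inferInstanceAs (FiniteDimensional ℝ (G₂ i))

end SumFamily

/-! ### Multipliers by type of constraint, and the discrete Euler equation. -/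

section

variable {Z G₁ G₂ G₃ E₁ E₀ : Type} [NormedAddCommGroup Z] [InnerProductSpace ℝ Z]
  [FiniteDimensional ℝ Z] [NormedAddCommGroup G₁] [InnerProductSpace ℝ G₁]
  [FiniteDimensional ℝ G₁] [NormedAddCommGroup G₂] [InnerProductSpace ℝ G₂]
  [FiniteDimensional ℝ G₂] [NormedAddCommGroup G₃] [InnerProductSpace ℝ G₃]
  [FiniteDimensional ℝ G₃] [NormedAddCommGroup E₁] [InnerProductSpace ℝ E₁]
  [FiniteDimensional ℝ E₁] [NormedAddCommGroup E₀] [InnerProductSpace ℝ E₀]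
  [FiniteDimensional ℝ E₀] {ι₁ ι₂ ι₃ κ : Type} [Fintype ι₁] [Fintype ι₂] [Fintype ι₃] [Fintype κ]

/-- The Lagrange multiplier rule for geometric constraints `H₁ i z ∈ C i`, equality constraints
`H₂ i z = 0` and `H₃ z = 0`, and inequality constraints `0 ≤ g i z`. -/
theorem exists_lagrange_multipliers {C : ι₁ → Set G₁} (hC : ∀ i, IsClosed (C i))
    {H₁ : ι₁ → Z → G₁} {H₂ : ι₂ → Z → G₂} {H₃ : Z → G₃} {g : ι₃ → Z → ℝ}
    {A : κ → Z →L[ℝ] E₁} {A₀ : Z →L[ℝ] E₀} {c : ℝ} (hc : 0 < c)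
    {f : κ → E₁ → WithTop ℝ} {f₀ : E₀ → WithTop ℝ} {ψ : κ → E₁ → ℝ} {ψ₀ : E₀ → ℝ}
    {s : Z → ℝ} {zbar : Z}
    (hmem₁ : ∀ i, H₁ i zbar ∈ C i) (hmem₂ : ∀ i, H₂ i zbar = 0) (hmem₃ : H₃ zbar = 0)
    (hmemg : ∀ i, 0 ≤ g i zbar)
    (hH₁ : ∀ i, ContDiffAt ℝ 1 (H₁ i) zbar) (hH₂ : ∀ i, ContDiffAt ℝ 1 (H₂ i) zbar)
    (hH₃ : ContDiffAt ℝ 1 H₃ zbar) (hg : ∀ i, ContDiffAt ℝ 1 (g i) zbar)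
    (hs : ContDiffAt ℝ 1 s zbar) {L : κ → NNReal} {U : κ → Set E₁} {L₀ : NNReal} {U₀ : Set E₀}
    (hU : ∀ r, U r ∈ 𝓝 (A r zbar)) (hψ : ∀ r, LipschitzOnWith (L r) (ψ r) (U r))
    (hfψ : ∀ r, ∀ y ∈ U r, f r y = (ψ r y : WithTop ℝ))
    (hU₀ : U₀ ∈ 𝓝 (A₀ zbar)) (hψ₀ : LipschitzOnWith L₀ ψ₀ U₀)
    (hfψ₀ : ∀ y ∈ U₀, f₀ y = (ψ₀ y : WithTop ℝ))
    (hmin : ∀ᶠ z in 𝓝 zbar, (∀ i, H₁ i z ∈ C i) → (∀ i, H₂ i z = 0) → H₃ z = 0 →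
      (∀ i, 0 ≤ g i z) →
      ψ₀ (A₀ zbar) + c * ∑ r, ψ r (A r zbar) + s zbar ≤ ψ₀ (A₀ z) + c * ∑ r, ψ r (A r z) + s z) :
    ∃ (lam : ℝ) (η : ι₁ → G₁) (π : ι₂ → G₂) (ζ : G₃) (α : ι₃ → ℝ) (ν : κ → E₁) (ν₀ : E₀),
      0 ≤ lam ∧ (∀ i, η i ∈ normalCone (C i) (H₁ i zbar)) ∧ (∀ i, 0 ≤ α i) ∧
      (∀ i, α i * g i zbar = 0) ∧ (∀ r, ν r ∈ subdiff (f r) (A r zbar)) ∧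
      ν₀ ∈ subdiff f₀ (A₀ zbar) ∧
      lam + (∑ i, ‖η i‖ + (∑ i, ‖π i‖ + (‖ζ‖ + ∑ i, ‖α i‖))) = 1 ∧
      ∀ δ, lam * (fderiv ℝ s zbar δ + (c * ∑ r, inner ℝ (ν r) (A r δ) + inner ℝ ν₀ (A₀ δ)))
        + (∑ i, inner ℝ (η i) (fderiv ℝ (H₁ i) zbar δ)
          + (∑ i, inner ℝ (π i) (fderiv ℝ (H₂ i) zbar δ)
            + (inner ℝ ζ (fderiv ℝ H₃ zbar δ) - ∑ i, α i * fderiv ℝ (g i) zbar δ))) = 0 := by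
  obtain ⟨lam, η, ν, hlam, hη, hν, hsum, hstat⟩ :=
    exists_multipliers (Z := Z) (ι := ι₁ ⊕ ι₂ ⊕ Unit ⊕ ι₃) (κ := κ ⊕ Unit)
    (G := Sum.elim (fun _ => G₁) (Sum.elim (fun _ => G₂) (Sum.elim (fun _ => G₃) (fun _ => ℝ))))
    (E := Sum.elim (fun _ => E₁) (fun _ => E₀))
    -- Every vector is normal to `{0}` at its point, so the multipliers of the equalities carry no
    -- sign condition; only the half-line imposes one.
    (C := fun j => match j with
      | .inl i => C i
      | .inr (.inl _) => ({0} : Set G₂)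
      | .inr (.inr (.inl _)) => ({0} : Set G₃)
      | .inr (.inr (.inr _)) => (Set.Ici 0 : Set ℝ))
    (H := fun j => match j with
      | .inl i => H₁ i
      | .inr (.inl i) => H₂ i
      | .inr (.inr (.inl _)) => H₃
      | .inr (.inr (.inr i)) => g i)
    (A := fun j => match j with
      | .inl r => A r
      | .inr _ => A₀)
    (c := Sum.elim (fun _ => c) (fun _ => 1))
    (f := fun j => match j with
      | .inl r => f r
      | .inr _ => f₀)
    (ψ := fun j => match j with
      | .inl r => ψ r
      | .inr _ => ψ₀)
    (s := s) (zbar := zbar) (L := Sum.elim L (fun _ => L₀))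
    (U := fun j => match j with
      | .inl r => U r
      | .inr _ => U₀)
    (by
      rintro (i | i | i | i)
      exacts [hC i, isClosed_singleton (X := G₂), isClosed_singleton (X := G₃),
        isClosed_Ici (α := ℝ)])
    (by rintro (r | r); exacts [hc, one_pos])
    (by
      rintro (i | i | i | i)
      exacts [hmem₁ i, hmem₂ i, hmem₃, hmemg i])
    (by
      rintro (i | i | i | i)
      exacts [hH₁ i, hH₂ i, hH₃, hg i])
    hs
    (by rintro (r | r); exacts [hU r, hU₀])
    (by rintro (r | r); exacts [hψ r, hψ₀])
    (by rintro (r | r); exacts [hfψ r, hfψ₀])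
    (by
      filter_upwards [hmin] with z hz hz'
      have h := hz (fun i => hz' (.inl i)) (fun i => hz' (.inr (.inl i)))
        (hz' (.inr (.inr (.inl ())))) (fun i => hz' (.inr (.inr (.inr i))))
      simp only [Fintype.sum_sum_type, Finset.univ_unique, Finset.sum_singleton, Sum.elim_inl,
        Sum.elim_inr, one_mul, ← Finset.mul_sum]
      have h' : s zbar + (c * ∑ r, ψ r (A r zbar) + ψ₀ (A₀ zbar))
        ≤ s z + (c * ∑ r, ψ r (A r z) + ψ₀ (A₀ z)) := by linarith
      exact h')
  -- Normals to `[0, ∞)` are nonpositive, so the multipliers of the inequalities are their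
  -- negatives.
  let a : ι₃ → ℝ := fun i => η (.inr (.inr (.inr i)))
  have hα : ∀ i, a i ≤ 0 ∧ a i * g i zbar = 0 := fun i =>
    normalCone_Ici (hη (.inr (.inr (.inr i))))
  refine ⟨lam, fun i => η (.inl i), fun i => η (.inr (.inl i)), η (.inr (.inr (.inl ()))),
    -a, fun r => ν (.inl r), ν (.inr ()), hlam,
    fun i => hη (.inl i), fun i => neg_nonneg.2 (hα i).1, fun i => ?_, fun r => hν (.inl r),
    hν (.inr ()), ?_, fun δ => ?_⟩
  · rw [Pi.neg_apply, neg_mul, neg_eq_zero]; exact (hα i).2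
  · simp only [Fintype.sum_sum_type, Finset.univ_unique, Finset.sum_singleton] at hsum
    rw [← hsum]
    simp only [Pi.neg_apply, norm_neg]
    rfl
  · have h := hstat δ
    simp only [Fintype.sum_sum_type, Finset.univ_unique, Finset.sum_singleton, Sum.elim_inl,
        Sum.elim_inr, one_mul, ← Finset.mul_sum] at h
    rw [← h, sub_eq_add_neg, ← Finset.sum_neg_distrib]
    have : ∀ i, -((-a) i * fderiv ℝ (g i) zbar δ)
        = inner ℝ (a i) (fderiv ℝ (g i) zbar δ) := fun i => by
      simp [mul_comm]
    simp only [this]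
    rfl

/-- First-order conditions for a linear functional of a finite sequence and its increments. -/
theorem euler_of_stationary {V : Type} [NormedAddCommGroup V] [InnerProductSpace ℝ V] {k : ℕ}
    {μ : Fin k → V} {p : Fin (k + 1) → V} {τ : V}
    (h : ∀ δ : Fin (k + 1) → V, ∑ j : Fin k, (inner ℝ (μ j) (δ j.castSucc)
      + inner ℝ (p j.succ) (δ j.succ - δ j.castSucc)) + inner ℝ (p 0) (δ 0)
      + inner ℝ τ (δ (Fin.last k)) = 0) :
    (∀ j : Fin k, μ j = p j.succ - p j.castSucc) ∧ p (Fin.last k) = -τ := by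
  have key : ∀ δ : Fin (k + 1) → V,
      ∑ j : Fin k, inner ℝ (μ j + p j.castSucc - p j.succ) (δ j.castSucc)
        + inner ℝ (p (Fin.last k) + τ) (δ (Fin.last k)) = 0 := by
    intro δ
    rw [← h δ]
    -- Splitting the same sum over all mesh points at its first and at its last term is the
    -- summation by parts.
    have h1 := Fin.sum_univ_succ (fun i => inner ℝ (p i) (δ i))
    have h2 := Fin.sum_univ_castSucc (fun i => inner ℝ (p i) (δ i))
    simp only [inner_add_left, inner_sub_left, inner_sub_right, Finset.sum_add_distrib,
      Finset.sum_sub_distrib]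
    linarith
  -- Testing with the coefficients themselves turns the identity into a vanishing sum of squares.
  have h3 := key (Fin.snoc (α := fun _ => V) (fun j => μ j + p j.castSucc - p j.succ)
    (p (Fin.last k) + τ))
  simp only [Fin.snoc_castSucc, Fin.snoc_last, real_inner_self_eq_norm_sq] at h3
  have h4 : 0 ≤ ∑ j : Fin k, ‖μ j + p j.castSucc - p j.succ‖ ^ 2 := by positivity
  have h5 := sq_nonneg ‖p (Fin.last k) + τ‖
  have h6 : ∑ j : Fin k, ‖μ j + p j.castSucc - p j.succ‖ ^ 2 = 0 := by linarith
  have h7 : ‖p (Fin.last k) + τ‖ ^ 2 = 0 := by linarith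
  rw [Finset.sum_eq_zero_iff_of_nonneg (fun _ _ => by positivity)] at h6
  refine ⟨fun j => ?_, ?_⟩
  · have := h6 j (Finset.mem_univ j)
    rw [sq_eq_zero_iff, norm_eq_zero] at this
    rw [← sub_eq_zero, ← this]; abel
  · rw [sq_eq_zero_iff, norm_eq_zero] at h7
    exact eq_neg_of_add_eq_zero_left h7

end

/-- Expanding the square leaves a quadratic polynomial in `v`, so the deviation from the reference
velocity is smooth without differentiating under the integral. -/
theorem integral_norm_sub_sq {V : Type} [NormedAddCommGroup V] [InnerProductSpace ℝ V]
    [CompleteSpace V] {w : ℝ → V} {a b : ℝ} (hw : IntervalIntegrable w volume a b)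
    (hw2 : IntervalIntegrable (fun r => ‖w r‖ ^ 2) volume a b) (v : V) :
    ∫ r in a..b, ‖v - w r‖ ^ 2
      = (b - a) * ‖v‖ ^ 2 - 2 * inner ℝ v (∫ r in a..b, w r) + ∫ r in a..b, ‖w r‖ ^ 2 := by
  have hin : IntervalIntegrable (fun r => inner ℝ v (w r)) volume a b :=
    ⟨hw.1.const_inner v, hw.2.const_inner v⟩
  have h1 : ∫ r in a..b, inner ℝ v (w r) = inner ℝ v (∫ r in a..b, w r) :=
    (innerSL ℝ v).intervalIntegral_comp_comm hw
  simp only [norm_sub_sq_real]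
  rw [intervalIntegral.integral_add (intervalIntegrable_const.sub (hin.const_mul 2)) hw2,
    intervalIntegral.integral_sub intervalIntegrable_const (hin.const_mul 2),
    intervalIntegral.integral_const, intervalIntegral.integral_const_mul, h1, smul_eq_mul]

/-! ### Derivatives of composite and quadratic maps. -/

section LinearMaps

variable {Z α β : Type} [NormedAddCommGroup Z] [NormedSpace ℝ Z] [NormedAddCommGroup α]
  [NormedSpace ℝ α] [NormedAddCommGroup β] [NormedSpace ℝ β]

/-- The continuous linear map `z ↦ (f z, g z)` into the Euclidean product. -/
def catL (f : Z →L[ℝ] α) (g : Z →L[ℝ] β) : Z →L[ℝ] (α ×ₑ β) :=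
  ((WithLp.prodContinuousLinearEquiv 2 ℝ α β).symm : α × β →L[ℝ] (α ×ₑ β)).comp (f.prod g)

@[simp] theorem catL_apply (f : Z →L[ℝ] α) (g : Z →L[ℝ] β) (z : Z) :
    catL f g z = (f z ⊠ g z) := rfl

/-- The derivative of `z ↦ f z - h • F (l z)`. -/
theorem hasFDerivAt_sub_smul_comp (f : Z →L[ℝ] β) (l : Z →L[ℝ] α) {F : α → β} {z : Z} (h : ℝ)
    (hF : ContDiffAt ℝ 1 F (l z)) : ContDiffAt ℝ 1 (fun z => f z - h • F (l z)) z ∧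
      HasFDerivAt (fun z => f z - h • F (l z)) (f - h • (fderiv ℝ F (l z)).comp l) z :=
  ⟨f.contDiff.contDiffAt.sub ((hF.comp z l.contDiff.contDiffAt).const_smul h),
    f.hasFDerivAt.sub ((HasFDerivAt.comp (g := F) z
      (hF.differentiableAt one_ne_zero).hasFDerivAt l.hasFDerivAt).const_smul h)⟩

/-- The derivative of a sum of quadratic functions of linear images. -/
theorem hasFDerivAt_sum_quadratic {V ι : Type} [Fintype ι] [NormedAddCommGroup V]
    [InnerProductSpace ℝ V] (v : ι → Z →L[ℝ] V) (h : ℝ) (w : ι → V) (c : ι → ℝ) (z : Z) :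
    ContDiff ℝ 1 (fun z => ∑ j, (h * ‖v j z‖ ^ 2 - 2 * inner ℝ (v j z) (w j) + c j)) ∧
    ∀ δ, fderiv ℝ (fun z => 1 / 2 * ∑ j, (h * ‖v j z‖ ^ 2 - 2 * inner ℝ (v j z) (w j) + c j)) z δ
      = ∑ j, inner ℝ (h • v j z - w j) (v j δ) := by
  refine ⟨ContDiff.sum fun j _ => ((contDiff_const.mul ((v j).contDiff.norm_sq ℝ)).sub
    (contDiff_const.mul ((v j).contDiff.inner ℝ contDiff_const))).add contDiff_const,
    fun δ => ?_⟩
  have hd := (HasFDerivAt.fun_sum (u := Finset.univ) fun j _ =>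
    (((((v j).hasFDerivAt (x := z)).norm_sq).const_mul h).sub
      ((((v j).hasFDerivAt (x := z)).inner ℝ (hasFDerivAt_const (w j) z)).const_mul 2)).add_const
        (c j)).const_mul (1 / 2)
  refine (DFunLike.congr_fun hd.fderiv δ).trans ?_
  simp only [smul_apply, sum_apply, smul_eq_mul]
  rw [Finset.mul_sum]
  refine Finset.sum_congr rfl fun j _ => ?_
  simp [inner_sub_left, inner_smul_left, real_inner_comm]
  ring

end LinearMaps

/-! ### Coordinates of the state and the pairing over one time step. -/

namespace State

variable {n m d : ℕ}

/-- The `x`-component as a linear map. -/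
def xL : State n m d →L[ℝ] Vec n := WithLp.fstL 2 ℝ _ _
/-- The `y`-component as a linear map. -/
def yL : State n m d →L[ℝ] Vec n := (WithLp.fstL 2 ℝ _ _).comp (WithLp.sndL 2 ℝ _ _)
/-- The `u`-component as a linear map. -/
def uL : State n m d →L[ℝ] Vec n :=
  (WithLp.fstL 2 ℝ _ _).comp ((WithLp.sndL 2 ℝ _ _).comp (WithLp.sndL 2 ℝ _ _))
/-- The `a`-component as a linear map. -/
def aL : State n m d →L[ℝ] Vec m :=
  (WithLp.fstL 2 ℝ _ _).comp ((WithLp.sndL 2 ℝ _ _).comp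
    ((WithLp.sndL 2 ℝ _ _).comp (WithLp.sndL 2 ℝ _ _)))
/-- The `b`-component as a linear map. -/
def bL : State n m d →L[ℝ] Vec d :=
  (WithLp.sndL 2 ℝ _ _).comp ((WithLp.sndL 2 ℝ _ _).comp
    ((WithLp.sndL 2 ℝ _ _).comp (WithLp.sndL 2 ℝ _ _)))


theorem inner_eq (z w : State n m d) : inner ℝ z w =
    inner ℝ z.x w.x + (inner ℝ z.y w.y + (inner ℝ z.u w.u + (inner ℝ z.a w.a
      + inner ℝ z.b w.b))) := rfl

end State

variable {n m d s : ℕ}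

/-- The contribution of one time step to the stationarity condition, in terms of the state and its
increment. -/
theorem step_pairing {h lam : ℝ} (hh : h ≠ 0) (θ δ D : State n m d) (ν : RunSpace n m d)
    (η : State n m d ×ₑ Vec n) (π : Vec n) (B : Vec d →L[ℝ] Vec n) (X : Vec n →L[ℝ] Vec n) :
    lam * (inner ℝ θ (h⁻¹ • D) + h * inner ℝ ν (δ.x ⊠ δ.u ⊠ δ.a ⊠ δ.b ⊠
        (h⁻¹ • D).x ⊠ (h⁻¹ • D).u ⊠ (h⁻¹ • D).a ⊠ (h⁻¹ • D).b))
      + (inner ℝ η (δ ⊠ -(h⁻¹ • D).x) + inner ℝ π (D.y - h • (B δ.b + X δ.x)))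
    = inner ℝ ((h * lam) • ν.fst + η.fst.x - h • ContinuousLinearMap.adjoint X π ⊠
        η.fst.y ⊠ (h * lam) • ν.snd.fst + η.fst.u ⊠ (h * lam) • ν.snd.snd.fst + η.fst.a ⊠
        (h * lam) • ν.snd.snd.snd.fst + η.fst.b - h • ContinuousLinearMap.adjoint B π) δ
      + inner ℝ (lam • (ν.snd.snd.snd.snd.fst + h⁻¹ • θ.x) - h⁻¹ • η.snd ⊠
        lam • h⁻¹ • θ.y + π ⊠ lam • (ν.snd.snd.snd.snd.snd.fst + h⁻¹ • θ.u) ⊠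
        lam • (ν.snd.snd.snd.snd.snd.snd.fst + h⁻¹ • θ.a) ⊠
        lam • (ν.snd.snd.snd.snd.snd.snd.snd + h⁻¹ • θ.b)) D := by
  have hx : (h⁻¹ • D).x = h⁻¹ • D.x := rfl
  have hu : (h⁻¹ • D).u = h⁻¹ • D.u := rfl
  have ha : (h⁻¹ • D).a = h⁻¹ • D.a := rfl
  have hb : (h⁻¹ • D).b = h⁻¹ • D.b := rfl
  have hη : inner ℝ η (δ ⊠ -(h⁻¹ • D).x) = inner ℝ η.fst δ + inner ℝ η.snd (-(h⁻¹ • D).x) := rfl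
  have hν : ∀ (x u : Vec n) (a : Vec m) (b : Vec d) (x' u' : Vec n) (a' : Vec m) (b' : Vec d),
      inner ℝ ν (x ⊠ u ⊠ a ⊠ b ⊠ x' ⊠ u' ⊠ a' ⊠ b') = inner ℝ ν.fst x + (inner ℝ ν.snd.fst u
        + (inner ℝ ν.snd.snd.fst a + (inner ℝ ν.snd.snd.snd.fst b
        + (inner ℝ ν.snd.snd.snd.snd.fst x' + (inner ℝ ν.snd.snd.snd.snd.snd.fst u'
        + (inner ℝ ν.snd.snd.snd.snd.snd.snd.fst a'
        + inner ℝ ν.snd.snd.snd.snd.snd.snd.snd b')))))) := fun _ _ _ _ _ _ _ _ => rfl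
  have hcat : ∀ (x y u : Vec n) (a : Vec m) (b : Vec d) (w : State n m d),
      inner ℝ (x ⊠ y ⊠ u ⊠ a ⊠ b) w = inner ℝ x w.x + (inner ℝ y w.y + (inner ℝ u w.u
        + (inner ℝ a w.a + inner ℝ b w.b))) := fun _ _ _ _ _ _ => rfl
  have hy : (h⁻¹ • D).y = h⁻¹ • D.y := rfl
  rw [hη, hν, State.inner_eq θ, State.inner_eq η.fst, hx, hy, hu, ha, hb, hcat, hcat]
  simp only [inner_add_left, inner_sub_left, inner_smul_left, inner_smul_right, inner_neg_right,
    inner_sub_right, inner_add_right, ContinuousLinearMap.adjoint_inner_left, RCLike.conj_to_real]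
  field_simp
  ring

/-! ### The discrete problem on the Euclidean space of paths. -/

namespace Problem

variable (P : Problem n m d s)

/-- The paths as a Euclidean space. -/
def PathSpace : Type := PiLp 2 (fun _ : Fin (P.k + 1) => State n m d)

noncomputable instance : NormedAddCommGroup P.PathSpace :=
  inferInstanceAs (NormedAddCommGroup (PiLp 2 (fun _ : Fin (P.k + 1) => State n m d)))

noncomputable instance : InnerProductSpace ℝ P.PathSpace :=
  inferInstanceAs (InnerProductSpace ℝ (PiLp 2 (fun _ : Fin (P.k + 1) => State n m d)))

instance : FiniteDimensional ℝ P.PathSpace :=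
  inferInstanceAs (FiniteDimensional ℝ (PiLp 2 (fun _ : Fin (P.k + 1) => State n m d)))

variable {P} in
/-- The path underlying a point of the Euclidean space of paths. -/
def PathSpace.path (z : P.PathSpace) : P.Path :=
  WithLp.ofLp (p := 2) (V := Fin (P.k + 1) → State n m d) z

/-- A path as a point of the Euclidean space of paths. -/
def ofPath (z : P.Path) : P.PathSpace :=
  WithLp.toLp (V := Fin (P.k + 1) → State n m d) 2 z

/-- The evaluation of a path at a mesh point. -/
noncomputable def stateL (i : Fin (P.k + 1)) : P.PathSpace →L[ℝ] State n m d :=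
  PiLp.proj (𝕜 := ℝ) 2 (fun _ : Fin (P.k + 1) => State n m d) i

/-- The discrete velocity as a linear map. -/
noncomputable def velL (j : Fin P.k) : P.PathSpace →L[ℝ] State n m d :=
  P.h⁻¹ • (P.stateL j.succ - P.stateL j.castSucc)

/-- The argument of the running cost as a linear map. -/
noncomputable def runArgL (j : Fin P.k) : P.PathSpace →L[ℝ] RunSpace n m d :=
  catL (State.xL.comp (P.stateL j.castSucc)) <| catL (State.uL.comp (P.stateL j.castSucc)) <|
  catL (State.aL.comp (P.stateL j.castSucc)) <| catL (State.bL.comp (P.stateL j.castSucc)) <|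
  catL (State.xL.comp (P.velL j)) <| catL (State.uL.comp (P.velL j)) <|
  catL (State.aL.comp (P.velL j)) (State.bL.comp (P.velL j))

/-- The point which the velocity inclusion requires to lie in the graph, as a linear map. -/
noncomputable def graphL (j : Fin P.k) : P.PathSpace →L[ℝ] (State n m d ×ₑ Vec n) :=
  catL (P.stateL j.castSucc) (-(State.xL.comp (P.velL j)))

/-- The difference `x_k - u_k` as a linear map. -/
noncomputable def endL : P.PathSpace →L[ℝ] Vec n :=
  State.xL.comp (P.stateL (Fin.last P.k)) - State.uL.comp (P.stateL (Fin.last P.k))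

/-- The argument `(b_j, x_j)` of `f₂` as a linear map. -/
noncomputable def bxL (j : Fin P.k) : P.PathSpace →L[ℝ] (Vec d ×ₑ Vec n) :=
  catL (State.bL.comp (P.stateL j.castSucc)) (State.xL.comp (P.stateL j.castSucc))

/-- The residual of the equation for `y`. -/
noncomputable def residual (j : Fin P.k) (z : P.PathSpace) : Vec n :=
  State.yL.comp (P.stateL j.succ - P.stateL j.castSucc) z - P.h • P.f2 (P.bxL j z)

variable {P}

theorem velL_apply (j : Fin P.k) (z : P.PathSpace) : P.velL j z = P.vel z.path j := rfl

theorem t_succ_sub (j : ℕ) : P.t (j + 1) - P.t j = P.h := by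
  simp only [t]; push_cast; ring

theorem h_pos (hk : 0 < P.k) (hT : 0 < P.T) : 0 < P.h := div_pos hT (by exact_mod_cast hk)

theorem step_subset (hk : 0 < P.k) (hT : 0 < P.T) (j : Fin P.k) :
    Set.Icc (P.t j) (P.t ((j : ℕ) + 1)) ⊆ Set.Icc 0 P.T := by
  have hh := h_pos hk hT
  have hjk : (((j : ℕ) + 1 : ℕ) : ℝ) ≤ P.k := by exact_mod_cast j.2
  refine Set.Icc_subset_Icc (mul_nonneg (Nat.cast_nonneg _) hh.le) ?_
  calc P.t ((j : ℕ) + 1) ≤ P.k * P.h := mul_le_mul_of_nonneg_right hjk hh.le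
    _ = P.T := mul_div_cancel₀ _ (by exact_mod_cast hk.ne')

theorem intervalIntegrable_dzbar (hk : 0 < P.k) (hT : 0 < P.T)
    (hzbar : IsW12Arc P.T P.zbar P.dzbar) (j : Fin P.k) :
    IntervalIntegrable P.dzbar volume (P.t j) (P.t ((j : ℕ) + 1)) ∧
      IntervalIntegrable (fun r => ‖P.dzbar r‖ ^ 2) volume (P.t j) (P.t ((j : ℕ) + 1)) := by
  have hle : P.t j ≤ P.t ((j : ℕ) + 1) := by
    have := t_succ_sub (P := P) j
    linarith [h_pos hk hT]
  have hsub := step_subset hk hT j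
  have hL : MemLp P.dzbar 2 (volume.restrict (Set.Icc (P.t j) (P.t ((j : ℕ) + 1)))) :=
    hzbar.1.mono_measure (Measure.restrict_mono hsub le_rfl)
  rw [intervalIntegrable_iff_integrableOn_Icc_of_le hle,
    intervalIntegrable_iff_integrableOn_Icc_of_le hle]
  exact ⟨hL.integrable (by norm_num), hL.integrable_norm_pow (p := 2) two_ne_zero⟩

theorem velDev_eq (hk : 0 < P.k) (hT : 0 < P.T) (hzbar : IsW12Arc P.T P.zbar P.dzbar)
    (z : P.Path) : P.velDev z = ∑ j : Fin P.k, (P.h * ‖P.vel z j‖ ^ 2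
      - 2 * inner ℝ (P.vel z j) (∫ r in (P.t j)..(P.t ((j : ℕ) + 1)), P.dzbar r)
      + ∫ r in (P.t j)..(P.t ((j : ℕ) + 1)), ‖P.dzbar r‖ ^ 2) := by
  refine Finset.sum_congr rfl fun j _ => ?_
  obtain ⟨h1, h2⟩ := intervalIntegrable_dzbar hk hT hzbar j
  rw [integral_norm_sub_sq h1 h2, t_succ_sub]

theorem theta_eq (hk : 0 < P.k) (hT : 0 < P.T) (hzbar : IsW12Arc P.T P.zbar P.dzbar)
    (z : P.Path) (j : Fin P.k) : P.theta z j =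
      P.h • P.vel z j - ∫ r in (P.t j)..(P.t ((j : ℕ) + 1)), P.dzbar r := by
  rw [theta, intervalIntegral.integral_sub intervalIntegrable_const
    (intervalIntegrable_dzbar hk hT hzbar j).1, intervalIntegral.integral_const, t_succ_sub]

theorem contDiff_velDev (hk : 0 < P.k) (hT : 0 < P.T) (hzbar : IsW12Arc P.T P.zbar P.dzbar) :
    ContDiff ℝ 1 (fun z : P.PathSpace => P.velDev z.path) := by
  simp only [velDev_eq hk hT hzbar, ← velL_apply]
  exact (hasFDerivAt_sum_quadratic P.velL _ _ _ 0).1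

/-- This is where the vectors θ come from: they are the gradients of the quadratic deviation with
respect to the discrete velocities, the factor one half cancelling the exponent. -/
theorem fderiv_half_velDev (hk : 0 < P.k) (hT : 0 < P.T) (hzbar : IsW12Arc P.T P.zbar P.dzbar)
    (z δ : P.PathSpace) : fderiv ℝ (fun z : P.PathSpace => 1 / 2 * P.velDev z.path) z δ
      = ∑ j : Fin P.k, inner ℝ (P.theta z.path j) (P.velL j δ) := by
  simp only [velDev_eq hk hT hzbar, theta_eq hk hT hzbar, ← velL_apply]
  exact (hasFDerivAt_sum_quadratic P.velL _ _ _ z).2 δ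

/-- Each partial Jacobian is the total derivative composed with the linear part of an affine slice,
and the two slices span the product. -/
theorem fderiv_f2 {z : P.Path} {j : Fin P.k}
    (hf2 : ContDiffAt ℝ 1 P.f2 ((z j.castSucc).b ⊠ (z j.castSucc).x)) (b : Vec d) (x : Vec n) :
    fderiv ℝ P.f2 ((z j.castSucc).b ⊠ (z j.castSucc).x) (b ⊠ x) = P.xiB z j b + P.xiX z j x := by
  have hd := (hf2.differentiableAt one_ne_zero).hasFDerivAt
  have hB : HasFDerivAt (fun b => P.f2 (b ⊠ (z j.castSucc).x)) _ (z j.castSucc).b :=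
    HasFDerivAt.comp (g := P.f2) _ hd
      ((((catL (ContinuousLinearMap.id ℝ (Vec d)) (0 : Vec d →L[ℝ] Vec n)).hasFDerivAt
        (x := (z j.castSucc).b)).const_add ((0 : Vec d) ⊠ (z j.castSucc).x)).congr_of_eventuallyEq
        (Eventually.of_forall fun b => by
          show (b ⊠ (z j.castSucc).x) = (0 ⊠ (z j.castSucc).x) + (b ⊠ 0)
          rw [← WithLp.toLp_add]; simp))
  have hX : HasFDerivAt (fun x => P.f2 ((z j.castSucc).b ⊠ x)) _ (z j.castSucc).x :=
    HasFDerivAt.comp (g := P.f2) _ hd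
      ((((catL (0 : Vec n →L[ℝ] Vec d) (ContinuousLinearMap.id ℝ (Vec n))).hasFDerivAt
        (x := (z j.castSucc).x)).const_add ((z j.castSucc).b ⊠ (0 : Vec n))).congr_of_eventuallyEq
        (Eventually.of_forall fun x => by
          show ((z j.castSucc).b ⊠ x) = ((z j.castSucc).b ⊠ 0) + (0 ⊠ x)
          rw [← WithLp.toLp_add]; simp))
  rw [xiB, xiX, hB.fderiv, hX.fderiv]
  simp only [ContinuousLinearMap.comp_apply, catL_apply, ← map_add]
  congr 1
  show (b ⊠ x) = (b ⊠ 0) + (0 ⊠ x)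
  rw [← WithLp.toLp_add]; simp

theorem contDiffAt_residual {z : P.PathSpace} {j : Fin P.k}
    (hf2 : ContDiffAt ℝ 1 P.f2 (P.bxL j z)) : ContDiffAt ℝ 1 (P.residual j) z :=
  (hasFDerivAt_sub_smul_comp _ _ P.h hf2).1

theorem fderiv_residual {z : P.PathSpace} {j : Fin P.k}
    (hf2 : ContDiffAt ℝ 1 P.f2 (P.bxL j z)) (δ : P.PathSpace) :
    fderiv ℝ (P.residual j) z δ = (δ.path j.succ - δ.path j.castSucc).y
      - P.h • (P.xiB z.path j (δ.path j.castSucc).b + P.xiX z.path j (δ.path j.castSucc).x) := by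
  rw [← fderiv_f2 (z := z.path) hf2]
  have h : fderiv ℝ (P.residual j) z = _ := (hasFDerivAt_sub_smul_comp
    (State.yL.comp (P.stateL j.succ - P.stateL j.castSucc)) (P.bxL j) P.h hf2).2.fderiv
  rw [h, sub_apply, smul_apply, ContinuousLinearMap.comp_apply, ContinuousLinearMap.comp_apply]
  rfl

/-- The real-valued form of the cost near a path at which the data are finite. -/
theorem cost_eq {z : P.Path} {φ : Vec n → ℝ} {ψ : Fin P.k → RunSpace n m d → ℝ}
    (hφ : P.phi (z (Fin.last P.k)).x = (φ (z (Fin.last P.k)).x : WithTop ℝ))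
    (hψ : ∀ j : Fin P.k, P.l0 (P.t j) (P.runArg z j) = (ψ j (P.runArg z j) : WithTop ℝ)) :
    P.cost z = ((φ (z (Fin.last P.k)).x + P.h * ∑ j, ψ j (P.runArg z j)
      + 1 / 2 * P.velDev z : ℝ) : WithTop ℝ) := by
  simp only [cost, hφ, hψ]
  push_cast
  rfl

/-- Because the step is nonzero, the witness `v` can only be minus the discrete velocity, which
eliminates the quantifier. -/
theorem inclusion_iff (hh : P.h ≠ 0) (z : P.PathSpace) (j : Fin P.k) :
    (∃ v ∈ P.F (z.path j.castSucc), (z.path j.succ).x = (z.path j.castSucc).x - P.h • v) ↔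
      P.graphL j z ∈ graph P.F := by
  have hx : (P.graphL j z).snd = -(P.h⁻¹ • ((z.path j.succ).x - (z.path j.castSucc).x)) := rfl
  show _ ↔ (P.graphL j z).snd ∈ P.F (z.path j.castSucc)
  rw [hx]
  constructor
  · rintro ⟨v, hv, h⟩
    rw [h]
    simpa [smul_smul, hh] using hv
  · intro h
    exact ⟨_, h, by simp [smul_smul, hh]⟩

end Problem

section

variable {Z V : Type} [NormedAddCommGroup Z] [NormedSpace ℝ Z] [NormedAddCommGroup V]
  [NormedSpace ℝ V]

theorem eventually_norm_apply_sub_lt (l : Z →L[ℝ] V) {c : V} {r : ℝ} {z : Z}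
    (h : ‖l z - c‖ < r) : ∀ᶠ y in 𝓝 z, ‖l y - c‖ < r :=
  ((l.continuous.sub continuous_const).norm.tendsto z).eventually (gt_mem_nhds h)

theorem contDiffAt_apply_and_fderiv (l : Z →L[ℝ] V) (z δ : Z) :
    ContDiffAt ℝ 1 (fun y => l y) z ∧ fderiv ℝ (fun y => l y) z δ = l δ :=
  ⟨l.contDiff.contDiffAt, DFunLike.congr_fun l.fderiv δ⟩

theorem fderiv_apply_sub_const (l : Z →L[ℝ] V) (c : V) (z δ : Z) :
    ContDiffAt ℝ 1 (fun y => l y - c) z ∧ fderiv ℝ (fun y => l y - c) z δ = l δ :=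
  ⟨l.contDiff.contDiffAt.sub contDiffAt_const,
    DFunLike.congr_fun (l.hasFDerivAt.sub_const c).fderiv δ⟩

theorem fderiv_comp_apply {f : V → ℝ} (l : Z →L[ℝ] V) {z : Z} (hf : ContDiffAt ℝ 1 f (l z))
    (δ : Z) : ContDiffAt ℝ 1 (fun y => f (l y)) z ∧
      fderiv ℝ (fun y => f (l y)) z δ = fderiv ℝ f (l z) (l δ) :=
  ⟨ContDiffAt.comp (g := f) z hf l.contDiff.contDiffAt,
    DFunLike.congr_fun (HasFDerivAt.comp (g := f) z
      (hf.differentiableAt one_ne_zero).hasFDerivAt l.hasFDerivAt).fderiv δ⟩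

end

/-! ### Local optimality and stationarity of the discrete problem. -/

namespace Problem

variable {n m d s : ℕ} {P : Problem n m d s}

theorem runArgL_apply (j : Fin P.k) (z : P.PathSpace) : P.runArgL j z = P.runArg z.path j := rfl

theorem stateL_apply (i : Fin (P.k + 1)) (z : P.PathSpace) : P.stateL i z = z.path i := rfl

theorem xL_stateL_apply (i : Fin (P.k + 1)) (z : P.PathSpace) :
    State.xL.comp (P.stateL i) z = (z.path i).x := rfl

theorem path_ofPath (z : P.Path) : (P.ofPath z).path = z := rfl

theorem graphL_apply (j : Fin P.k) (z : P.PathSpace) :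
    P.graphL j z = (z.path j.castSucc ⊠ -(P.vel z.path j).x) := rfl

theorem residual_apply (j : Fin P.k) (z : P.PathSpace) : P.residual j z =
    (z.path j.succ - z.path j.castSucc).y
      - P.h • P.f2 ((z.path j.castSucc).b ⊠ (z.path j.castSucc).x) := rfl

theorem endL_apply (z : P.PathSpace) :
    P.endL z = (z.path (Fin.last P.k)).x - (z.path (Fin.last P.k)).u := rfl

theorem residual_eq_zero_iff (j : Fin P.k) (z : P.PathSpace) : P.residual j z = 0 ↔
    (z.path j.succ).y = (z.path j.castSucc).y
      + P.h • P.f2 ((z.path j.castSucc).b ⊠ (z.path j.castSucc).x) := by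
  rw [residual_apply, show (z.path j.succ - z.path j.castSucc).y
    = (z.path j.succ).y - (z.path j.castSucc).y from rfl, sub_sub, sub_eq_zero]

/-- The initial point prescribed by the constraints. -/
noncomputable def init (P : Problem n m d s) : State n m d :=
  P.x0 ⊠ 0 ⊠ (P.zbar 0).u ⊠ (P.zbar 0).a ⊠ (P.zbar 0).b

/-- Strict inequalities between continuous functions persist nearby, so the localization constraints
contribute no multipliers. -/
theorem eventually_local_constraints (hk : 0 < P.k) (hT : 0 < P.T)
    (hzbar : IsW12Arc P.T P.zbar P.dzbar) {z : P.Path}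
    (hstate : ∀ j : Fin P.k, ‖z j.castSucc - P.zbar (P.t j)‖ < P.eps / 2)
    (hvel : P.velDev z < P.eps / 2) : ∀ᶠ y in 𝓝 (P.ofPath z),
      (∀ j : Fin P.k, ‖y.path j.castSucc - P.zbar (P.t j)‖ ≤ P.eps / 2) ∧
        P.velDev y.path ≤ P.eps / 2 := by
  refine (eventually_all.2 fun j => ?_).and ?_
  · exact (eventually_norm_apply_sub_lt (P.stateL j.castSucc) (z := P.ofPath z)
      (hstate j)).mono fun y hy => by
        rw [stateL_apply] at hy
        exact le_of_lt hy
  · exact (((contDiff_velDev hk hT hzbar).continuous.tendsto (P.ofPath z)).eventually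
      (gt_mem_nhds hvel)).mono fun y hy => le_of_lt hy

theorem feasible_of_mem (hh : P.h ≠ 0) {y : P.PathSpace} (k1 : ∀ j, P.graphL j y ∈ graph P.F)
    (k2 : ∀ j, P.residual j y = 0) (k3 : P.stateL 0 y - P.init = 0)
    (k4 : ∀ i, 0 ≤ P.g i (P.endL y))
    (h1 : ∀ j : Fin P.k, ‖y.path j.castSucc - P.zbar (P.t j)‖ ≤ P.eps / 2)
    (h2 : P.velDev y.path ≤ P.eps / 2) : P.Feasible y.path where
  inclusion j := (inclusion_iff hh y j).2 (k1 j)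
  integral j := (residual_eq_zero_iff j y).1 (k2 j)
  initial := by rw [stateL_apply] at k3; exact sub_eq_zero.1 k3
  endpoint i := by rw [← endL_apply]; exact k4 i
  local_state := h1
  local_vel := h2

/-- Near the optimal path localization is automatic and the costs are finite, so global optimality
in the extended reals becomes the real local minimality that the multiplier rule requires. -/
theorem eventually_cost_le (hk : 0 < P.k) (hT : 0 < P.T)
    (hzbar : IsW12Arc P.T P.zbar P.dzbar) {z : P.Path} (hz : P.IsOptimal z)
    (hstate : ∀ j : Fin P.k, ‖z j.castSucc - P.zbar (P.t j)‖ < P.eps / 2)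
    (hvel : P.velDev z < P.eps / 2) {U₀ : Set (Vec n)} {U : Fin P.k → Set (RunSpace n m d)}
    {ψ₀ : Vec n → ℝ} {ψ : Fin P.k → RunSpace n m d → ℝ}
    (hU₀ : U₀ ∈ 𝓝 (z (Fin.last P.k)).x) (hfψ₀ : ∀ y ∈ U₀, P.phi y = (ψ₀ y : WithTop ℝ))
    (hU : ∀ j, U j ∈ 𝓝 (P.runArg z j))
    (hfψ : ∀ j, ∀ y ∈ U j, P.l0 (P.t j) y = (ψ j y : WithTop ℝ)) :
    ∀ᶠ y in 𝓝 (P.ofPath z), (∀ j, P.graphL j y ∈ graph P.F) →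
      (∀ j, P.residual j y = 0) → P.stateL 0 y - P.init = 0 → (∀ i, 0 ≤ P.g i (P.endL y)) →
      ψ₀ ((State.xL.comp (P.stateL (Fin.last P.k))) (P.ofPath z))
        + P.h * ∑ j, ψ j (P.runArgL j (P.ofPath z)) + 1 / 2 * P.velDev (P.ofPath z).path
      ≤ ψ₀ ((State.xL.comp (P.stateL (Fin.last P.k))) y)
        + P.h * ∑ j, ψ j (P.runArgL j y) + 1 / 2 * P.velDev y.path := by
  have e3 : ∀ᶠ y in 𝓝 (P.ofPath z), (State.xL.comp (P.stateL (Fin.last P.k))) y ∈ U₀ :=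
    ((State.xL.comp (P.stateL (Fin.last P.k))).continuous.tendsto (P.ofPath z)).eventually hU₀
  have e4 : ∀ᶠ y in 𝓝 (P.ofPath z), ∀ j, P.runArgL j y ∈ U j := eventually_all.2 fun j =>
    ((P.runArgL j).continuous.tendsto (P.ofPath z)).eventually (hU j)
  filter_upwards [eventually_local_constraints hk hT hzbar hstate hvel, e3, e4]
    with y h1 h3 h4 k1 k2 k3 k4
  have hle := hz.2 _ (feasible_of_mem (h_pos hk hT).ne' k1 k2 k3 k4 h1.1 h1.2)
  simp only [xL_stateL_apply, runArgL_apply, path_ofPath] at h3 h4 ⊢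
  rw [cost_eq (hfψ₀ _ h3) fun j => hfψ j _ (h4 j),
    cost_eq (hfψ₀ _ (mem_of_mem_nhds hU₀)) fun j => hfψ j _ (mem_of_mem_nhds (hU j))] at hle
  exact WithTop.coe_le_coe.1 hle

theorem fderiv_endpoint {z : P.Path} (i : Fin s)
    (hg : ContDiffAt ℝ 1 (P.g i) ((z (Fin.last P.k)).x - (z (Fin.last P.k)).u)) (δ : P.Path) :
    fderiv ℝ (fun y => P.g i (P.endL y)) (P.ofPath z) (P.ofPath δ)
      = inner ℝ (gradient (P.g i) ((z (Fin.last P.k)).x - (z (Fin.last P.k)).u))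
          ((δ (Fin.last P.k)).x - (δ (Fin.last P.k)).u) := by
  rw [(fderiv_comp_apply P.endL (z := P.ofPath z) hg _).2, endL_apply, endL_apply, path_ofPath,
    path_ofPath, gradient, InnerProductSpace.toDual_symm_apply]

/-- The multiplier rule for the discrete problem, as a stationarity condition. -/
theorem exists_stationary (hk : 0 < P.k) (hT : 0 < P.T) (hzbar : IsW12Arc P.T P.zbar P.dzbar)
    (hF : IsClosed (graph P.F)) (z : P.Path) (hz : P.IsOptimal z)
    (hstate : ∀ j : Fin P.k, ‖z j.castSucc - P.zbar (P.t j)‖ < P.eps / 2)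
    (hvel : P.velDev z < P.eps / 2)
    (hphi : LocLipschitzAt P.phi (z (Fin.last P.k)).x)
    (hl0 : ∀ j : Fin P.k, LocLipschitzAt (P.l0 (P.t j)) (P.runArg z j))
    (hf2 : ∀ j : Fin P.k, ContDiffAt ℝ 1 P.f2 ((z j.castSucc).b ⊠ (z j.castSucc).x))
    (hg : ∀ i : Fin s,
      ContDiffAt ℝ 1 (P.g i) ((z (Fin.last P.k)).x - (z (Fin.last P.k)).u)) :
    ∃ (lam : ℝ) (η : Fin P.k → State n m d ×ₑ Vec n) (π : Fin P.k → Vec n) (ζ : State n m d)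
      (α : Fin s → ℝ) (ν : Fin P.k → RunSpace n m d) (ν₀ : Vec n),
      0 ≤ lam ∧ (∀ j, η j ∈ normalCone (graph P.F) (z j.castSucc ⊠ -(P.vel z j).x)) ∧
      (∀ i, 0 ≤ α i) ∧
      (∀ i, α i * P.g i ((z (Fin.last P.k)).x - (z (Fin.last P.k)).u) = 0) ∧
      (∀ j : Fin P.k, ν j ∈ subdiff (P.l0 (P.t j)) (P.runArg z j)) ∧
      ν₀ ∈ subdiff P.phi (z (Fin.last P.k)).x ∧
      lam + (∑ j, ‖η j‖ + (∑ j, ‖π j‖ + (‖ζ‖ + ∑ i, ‖α i‖))) = 1 ∧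
      ∀ δ : P.Path,
        lam * (∑ j, inner ℝ (P.theta z j) (P.vel δ j)
            + (P.h * ∑ j, inner ℝ (ν j) (P.runArg δ j) + inner ℝ ν₀ (δ (Fin.last P.k)).x))
        + (∑ j, inner ℝ (η j) (δ j.castSucc ⊠ -(P.vel δ j).x)
          + (∑ j, inner ℝ (π j) ((δ j.succ - δ j.castSucc).y
              - P.h • (P.xiB z j (δ j.castSucc).b + P.xiX z j (δ j.castSucc).x))
            + (inner ℝ ζ (δ 0) - ∑ i, α i *
              inner ℝ (gradient (P.g i) ((z (Fin.last P.k)).x - (z (Fin.last P.k)).u))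
                ((δ (Fin.last P.k)).x - (δ (Fin.last P.k)).u)))) = 0 := by
  have hh := h_pos hk hT
  obtain ⟨U₀, hU₀, L₀, ψ₀, hψ₀, hfψ₀⟩ := hphi
  choose U hU L ψ hψ hfψ using hl0
  have hmin := eventually_cost_le hk hT hzbar hz hstate hvel hU₀ hfψ₀ hU hfψ
  have m1 : ∀ j, P.graphL j (P.ofPath z) ∈ graph P.F := fun j =>
    (inclusion_iff hh.ne' _ j).1 (hz.1.inclusion j)
  have m2 : ∀ j, P.residual j (P.ofPath z) = 0 := fun j =>
    (residual_eq_zero_iff j _).2 (hz.1.integral j)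
  have m3 : P.stateL 0 (P.ofPath z) - P.init = 0 := sub_eq_zero.2 hz.1.initial
  have m4 : ∀ i, 0 ≤ P.g i (P.endL (P.ofPath z)) := hz.1.endpoint
  have c1 : ∀ j, ContDiffAt ℝ 1 (P.graphL j) (P.ofPath z) := fun j =>
    (contDiffAt_apply_and_fderiv (P.graphL j) (P.ofPath z) 0).1
  have c2 : ∀ j, ContDiffAt ℝ 1 (P.residual j) (P.ofPath z) := fun j =>
    contDiffAt_residual (hf2 j)
  have c3 : ContDiffAt ℝ 1 (fun y => P.stateL 0 y - P.init) (P.ofPath z) :=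
    (fderiv_apply_sub_const (P.stateL 0) P.init (P.ofPath z) 0).1
  have c4 : ∀ i, ContDiffAt ℝ 1 (fun y => P.g i (P.endL y)) (P.ofPath z) := fun i =>
    (fderiv_comp_apply P.endL (hg i) 0).1
  have c5 : ContDiffAt ℝ 1 (fun y : P.PathSpace => 1 / 2 * P.velDev y.path) (P.ofPath z) :=
    (contDiff_const.mul (contDiff_velDev hk hT hzbar)).contDiffAt
  obtain ⟨lam, η, π, ζ, α, ν, ν₀, hlam, hη, hα, hαg, hν, hν₀, hsum, hstat⟩ :=
    exists_lagrange_multipliers (C := fun _ : Fin P.k => graph P.F) (fun _ => hF)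
    (H₁ := fun j => P.graphL j) (H₂ := P.residual) (H₃ := fun y => P.stateL 0 y - P.init)
    (g := fun i y => P.g i (P.endL y)) (A := P.runArgL)
    (A₀ := State.xL.comp (P.stateL (Fin.last P.k))) hh
    (f := fun j => P.l0 (P.t j)) (f₀ := P.phi) (ψ := ψ) (ψ₀ := ψ₀)
    (s := fun y => 1 / 2 * P.velDev y.path) (zbar := P.ofPath z)
    m1 m2 m3 m4 c1 c2 c3 c4 c5 hU hψ hfψ hU₀ hψ₀ hfψ₀ hmin
  refine ⟨lam, η, π, ζ, α, ν, ν₀, hlam, hη, hα, hαg, hν, hν₀, hsum, fun δ => ?_⟩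
  have h := hstat (P.ofPath δ)
  rw [fderiv_half_velDev hk hT hzbar] at h
  have f1 := fun j => (contDiffAt_apply_and_fderiv (P.graphL j) (P.ofPath z) (P.ofPath δ)).2
  have f3 := (fderiv_apply_sub_const (P.stateL 0) P.init (P.ofPath z) (P.ofPath δ)).2
  simp only [f1, f3, fun i => fderiv_endpoint i (hg i) δ,
    fun j => fderiv_residual (z := P.ofPath z) (hf2 j) (P.ofPath δ)] at h
  simp only [graphL_apply, velL_apply, runArgL_apply, stateL_apply, xL_stateL_apply,
    path_ofPath] at h
  exact h

end Problem

end DiscreteSweeping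

/-! ### The adjoint sequence and the necessary conditions. -/

theorem theorem7p1 {n m d s : ℕ} (P : Problem n m d s)
    (hk : 0 < P.k) (hT : 0 < P.T) (heps : 0 < P.eps)
    -- the reference arc is in `W^{1,2}`; the velocity mapping has a closed graph
    (hzbar : IsW12Arc P.T P.zbar P.dzbar)
    (hF : IsClosed (graph P.F))
    -- an optimal solution at which the localization constraints are inactive
    (z : P.Path) (hz : P.IsOptimal z)
    (hstate : ∀ j : Fin P.k, ‖z j.castSucc - P.zbar (P.t j)‖ < P.eps / 2)
    (hvel : P.velDev z < P.eps / 2)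
    -- regularity of the data around the optimal solution
    (hphi : LocLipschitzAt P.phi (z (Fin.last P.k)).x)
    (hl0 : ∀ j : Fin P.k, LocLipschitzAt (P.l0 (P.t j)) (P.runArg z j))
    (hf2 : ∀ j : Fin P.k, ContDiffAt ℝ 1 P.f2 ((z j.castSucc).b ⊠ (z j.castSucc).x))
    (hg : ∀ i : Fin s,
      ContDiffAt ℝ 1 (P.g i) ((z (Fin.last P.k)).x - (z (Fin.last P.k)).u)) :
    ∃ (lam : ℝ) (α : Vec s)
      (px py pu : Fin (P.k + 1) → Vec n) (pa : Fin (P.k + 1) → Vec m)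
      (pb : Fin (P.k + 1) → Vec d)
      -- `pd j` is the multiplier with index `j + 1`
      (pd : Fin P.k → Vec n)
      (wx wu : Fin P.k → Vec n) (wa : Fin P.k → Vec m) (wb : Fin P.k → Vec d)
      (vx vu : Fin P.k → Vec n) (va : Fin P.k → Vec m) (vb : Fin P.k → Vec d),
      0 ≤ lam ∧ (∀ i, 0 ≤ α i) ∧
      -- subgradients of the running cost
      (∀ j : Fin P.k, (wx j ⊠ wu j ⊠ wa j ⊠ wb j ⊠ vx j ⊠ vu j ⊠ va j ⊠ vb j) ∈
        subdiff (P.l0 (P.t j)) (P.runArg z j)) ∧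
      -- nontriviality
      lam + ‖α‖ + ∑ j : Fin P.k, ‖px j.castSucc‖ + ∑ j : Fin P.k, ‖pd j‖
        + ‖py 0‖ + ‖pu 0‖ + ‖pa 0‖ + ‖pb 0‖ ≠ 0 ∧
      -- complementary slackness
      (∀ i : Fin s, α i * P.g i ((z (Fin.last P.k)).x - (z (Fin.last P.k)).u) = 0) ∧
      -- transversality
      (∃ ν ∈ subdiff P.phi (z (Fin.last P.k)).x,
        -px (Fin.last P.k) = lam • ν
          - ∑ i : Fin s, α i • gradient (P.g i) ((z (Fin.last P.k)).x - (z (Fin.last P.k)).u)) ∧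
      -pu (Fin.last P.k) =
        ∑ i : Fin s, α i • gradient (P.g i) ((z (Fin.last P.k)).x - (z (Fin.last P.k)).u) ∧
      py (Fin.last P.k) = 0 ∧ pa (Fin.last P.k) = 0 ∧ pb (Fin.last P.k) = 0 ∧
      -- explicit relations
      (∀ j : Fin P.k,
        py j.succ = lam • P.h⁻¹ • (P.theta z j).y + P.h⁻¹ • pd j ∧
        pu j.succ = lam • (vu j + P.h⁻¹ • (P.theta z j).u) ∧
        pa j.succ = lam • (va j + P.h⁻¹ • (P.theta z j).a) ∧
        pb j.succ = lam • (vb j + P.h⁻¹ • (P.theta z j).b)) ∧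
      -- discrete Euler–Lagrange inclusions
      (∀ j : Fin P.k,
        ((P.h⁻¹ • (px j.succ - px j.castSucc) - lam • wx j
              + P.h⁻¹ • ContinuousLinearMap.adjoint (P.xiX z j) (pd j)
            ⊠ P.h⁻¹ • (py j.succ - py j.castSucc)
            ⊠ P.h⁻¹ • (pu j.succ - pu j.castSucc) - lam • wu j
            ⊠ P.h⁻¹ • (pa j.succ - pa j.castSucc) - lam • wa j
            ⊠ P.h⁻¹ • (pb j.succ - pb j.castSucc) - lam • wb j
              + P.h⁻¹ • ContinuousLinearMap.adjoint (P.xiB z j) (pd j))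
          ⊠ lam • (vx j + P.h⁻¹ • (P.theta z j).x) - px j.succ) ∈
        normalCone (graph P.F) (z j.castSucc ⊠ -(P.vel z j).x)) := by
  have hh := Problem.h_pos hk hT
  obtain ⟨lam, η, π, ζ, α, ν, ν₀, hlam, hη, hα, hαg, hν, hν₀, hsum, hstat⟩ :=
    Problem.exists_stationary hk hT hzbar hF z hz hstate hvel hphi hl0 hf2 hg
  set Γ : Vec n := ∑ i : Fin s,
    α i • gradient (P.g i) ((z (Fin.last P.k)).x - (z (Fin.last P.k)).u) with hΓ
  let q : Fin P.k → State n m d := fun j =>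
    lam • ((ν j).snd.snd.snd.snd.fst + P.h⁻¹ • (P.theta z j).x) - P.h⁻¹ • (η j).snd ⊠
      lam • P.h⁻¹ • (P.theta z j).y + π j ⊠
      lam • ((ν j).snd.snd.snd.snd.snd.fst + P.h⁻¹ • (P.theta z j).u) ⊠
      lam • ((ν j).snd.snd.snd.snd.snd.snd.fst + P.h⁻¹ • (P.theta z j).a) ⊠
      lam • ((ν j).snd.snd.snd.snd.snd.snd.snd + P.h⁻¹ • (P.theta z j).b)
  let μ : Fin P.k → State n m d := fun j =>
    (P.h * lam) • (ν j).fst + (η j).fst.x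
        - P.h • ContinuousLinearMap.adjoint (P.xiX z j) (π j) ⊠
      (η j).fst.y ⊠ (P.h * lam) • (ν j).snd.fst + (η j).fst.u ⊠
      (P.h * lam) • (ν j).snd.snd.fst + (η j).fst.a ⊠
      (P.h * lam) • (ν j).snd.snd.snd.fst + (η j).fst.b
        - P.h • ContinuousLinearMap.adjoint (P.xiB z j) (π j)
  -- The multiplier of the initial condition serves as `p 0`; the coefficient of the increment over
  -- step `j` is the adjoint vector with index `j + 1`.
  let p : Fin (P.k + 1) → State n m d := Fin.cons ζ q
  have hp0 : p 0 = ζ := rfl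
  have hpsucc : ∀ j, p j.succ = q j := fun j => rfl
  obtain ⟨hμ, hplast⟩ := euler_of_stationary (μ := μ) (p := p)
    (τ := (lam • ν₀ - Γ ⊠ 0 ⊠ Γ ⊠ 0 ⊠ 0)) (by
      intro δ
      have hstep : ∀ j, inner ℝ (μ j) (δ j.castSucc)
          + inner ℝ (p j.succ) (δ j.succ - δ j.castSucc) = _ := fun j =>
        (step_pairing (lam := lam) hh.ne' (P.theta z j) (δ j.castSucc)
          (δ j.succ - δ j.castSucc) (ν j) (η j) (π j) (P.xiB z j) (P.xiX z j)).symm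
      have hlast : inner ℝ (lam • ν₀ - Γ ⊠ 0 ⊠ Γ ⊠ 0 ⊠ 0 : State n m d) (δ (Fin.last P.k))
          = lam * inner ℝ ν₀ (δ (Fin.last P.k)).x - ∑ i, α i *
              inner ℝ (gradient (P.g i) ((z (Fin.last P.k)).x - (z (Fin.last P.k)).u))
                ((δ (Fin.last P.k)).x - (δ (Fin.last P.k)).u) := by
        have h1 : inner ℝ (lam • ν₀ - Γ ⊠ 0 ⊠ Γ ⊠ 0 ⊠ 0 : State n m d) (δ (Fin.last P.k))
          = inner ℝ (lam • ν₀ - Γ) (δ (Fin.last P.k)).x + (inner ℝ 0 (δ (Fin.last P.k)).y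
            + (inner ℝ Γ (δ (Fin.last P.k)).u + (inner ℝ 0 (δ (Fin.last P.k)).a
            + inner ℝ 0 (δ (Fin.last P.k)).b))) := rfl
        have h2 : ∑ i, α i *
              inner ℝ (gradient (P.g i) ((z (Fin.last P.k)).x - (z (Fin.last P.k)).u))
                ((δ (Fin.last P.k)).x - (δ (Fin.last P.k)).u)
            = inner ℝ Γ ((δ (Fin.last P.k)).x - (δ (Fin.last P.k)).u) := by
          rw [hΓ, sum_inner]
          exact Finset.sum_congr rfl fun i _ => (real_inner_smul_left _ _ _).symm
        rw [h1, h2]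
        simp only [inner_sub_left, inner_sub_right, real_inner_smul_left, inner_zero_left]
        ring
      rw [hlast, Finset.sum_congr rfl fun j _ => hstep j, hp0]
      refine Eq.trans ?_ (hstat δ)
      simp only [Finset.sum_add_distrib, ← Finset.mul_sum]
      have h3 : ∀ j, P.vel δ j = P.h⁻¹ • (δ j.succ - δ j.castSucc) := fun j => rfl
      simp only [Problem.runArg, h3]
      ring)
  -- The terms in the subgradients, θ and the Jacobians cancel, leaving the graph normal scaled by
  -- `P.h⁻¹`; the normal cone is stable under this scaling.
  have hnormal : ∀ j : Fin P.k,
      ((P.h⁻¹ • ((p j.succ).x - (p j.castSucc).x) - lam • (ν j).fst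
            + P.h⁻¹ • ContinuousLinearMap.adjoint (P.xiX z j) (P.h • π j)
          ⊠ P.h⁻¹ • ((p j.succ).y - (p j.castSucc).y)
          ⊠ P.h⁻¹ • ((p j.succ).u - (p j.castSucc).u) - lam • (ν j).snd.fst
          ⊠ P.h⁻¹ • ((p j.succ).a - (p j.castSucc).a) - lam • (ν j).snd.snd.fst
          ⊠ P.h⁻¹ • ((p j.succ).b - (p j.castSucc).b) - lam • (ν j).snd.snd.snd.fst
            + P.h⁻¹ • ContinuousLinearMap.adjoint (P.xiB z j) (P.h • π j))
        ⊠ lam • ((ν j).snd.snd.snd.snd.fst + P.h⁻¹ • (P.theta z j).x) - (p j.succ).x)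
      = P.h⁻¹ • η j := by
    intro j
    have hx : (p j.succ).x - (p j.castSucc).x = (P.h * lam) • (ν j).fst + (η j).fst.x
        - P.h • ContinuousLinearMap.adjoint (P.xiX z j) (π j) := (congrArg State.x (hμ j)).symm
    have hy : (p j.succ).y - (p j.castSucc).y = (η j).fst.y := (congrArg State.y (hμ j)).symm
    have hu : (p j.succ).u - (p j.castSucc).u = (P.h * lam) • (ν j).snd.fst + (η j).fst.u :=
      (congrArg State.u (hμ j)).symm
    have ha : (p j.succ).a - (p j.castSucc).a = (P.h * lam) • (ν j).snd.snd.fst + (η j).fst.a :=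
      (congrArg State.a (hμ j)).symm
    have hb : (p j.succ).b - (p j.castSucc).b = (P.h * lam) • (ν j).snd.snd.snd.fst + (η j).fst.b
        - P.h • ContinuousLinearMap.adjoint (P.xiB z j) (π j) := (congrArg State.b (hμ j)).symm
    have hq : (p j.succ).x = lam • ((ν j).snd.snd.snd.snd.fst + P.h⁻¹ • (P.theta z j).x)
        - P.h⁻¹ • (η j).snd := rfl
    rw [hx, hy, hu, ha, hb, hq]
    have c : ∀ {V : Type} [AddCommGroup V] [Module ℝ V] (v e : V),
        P.h⁻¹ • ((P.h * lam) • v + e) - lam • v = P.h⁻¹ • e := fun v e => by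
      rw [smul_add, smul_smul, inv_mul_cancel_left₀ hh.ne', add_sub_cancel_left]
    have c' : ∀ {V : Type} [AddCommGroup V] [Module ℝ V] (v e w : V),
        P.h⁻¹ • ((P.h * lam) • v + e - P.h • w) - lam • v + P.h⁻¹ • P.h • w = P.h⁻¹ • e :=
      fun v e w => by rw [← c v e, smul_sub]; abel
    simp only [map_smul, c, c', sub_sub_cancel]
    rfl
  -- Taking `pd` to be `P.h • π` matches the factors `P.h⁻¹` in the relation for `py` and in the
  -- adjoint Jacobian terms.
  refine ⟨lam, WithLp.toLp 2 α, fun i => (p i).x, fun i => (p i).y, fun i => (p i).u,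
    fun i => (p i).a, fun i => (p i).b, fun j => P.h • π j, fun j => (ν j).fst,
    fun j => (ν j).snd.fst, fun j => (ν j).snd.snd.fst, fun j => (ν j).snd.snd.snd.fst,
    fun j => (ν j).snd.snd.snd.snd.fst, fun j => (ν j).snd.snd.snd.snd.snd.fst,
    fun j => (ν j).snd.snd.snd.snd.snd.snd.fst, fun j => (ν j).snd.snd.snd.snd.snd.snd.snd,
    hlam, hα, hν, ?_, hαg, ⟨ν₀, hν₀, ?_⟩, ?_, ?_, ?_, ?_, fun j => ⟨?_, rfl, rfl, rfl⟩,
    fun j => ?_⟩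
  · intro h0
    have hpx := Finset.sum_nonneg fun (j : Fin P.k) (_ : j ∈ Finset.univ) =>
      norm_nonneg (p j.castSucc).x
    have hpd := Finset.sum_nonneg fun (j : Fin P.k) (_ : j ∈ Finset.univ) =>
      norm_nonneg (P.h • π j)
    have hα0 := norm_nonneg (WithLp.toLp 2 α : Vec s)
    have hy0 := norm_nonneg (p 0).y
    have hu0 := norm_nonneg (p 0).u
    have ha0 := norm_nonneg (p 0).a
    have hb0 := norm_nonneg (p 0).b
    have zlam : lam = 0 := by linarith
    have zα : ∀ i, α i = 0 := fun i => by
      have : (WithLp.toLp 2 α : Vec s) = 0 := norm_eq_zero.1 (by linarith)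
      exact congrArg (fun v : Vec s => v i) this
    have zpx : ∀ j : Fin P.k, (p j.castSucc).x = 0 := fun j => norm_eq_zero.1
      ((Finset.sum_eq_zero_iff_of_nonneg fun (j : Fin P.k) _ => norm_nonneg (p j.castSucc).x).1
        (by linarith) j (Finset.mem_univ j))
    have zπ : ∀ j, π j = 0 := fun j => (smul_eq_zero.1 (norm_eq_zero.1
      ((Finset.sum_eq_zero_iff_of_nonneg fun (j : Fin P.k) _ => norm_nonneg (P.h • π j)).1
        (by linarith) j (Finset.mem_univ j)))).resolve_left hh.ne'
    have zΓ : Γ = 0 := by simp [hΓ, zα]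
    -- The nontriviality sum omits the terminal `x`-component, which vanishes by transversality once
    -- `lam` and `α` do. The later `y`, `u`, `a`, `b` components vanish by their explicit formulas.
    have zx : ∀ i, (p i).x = 0 := fun i => by
      refine Fin.lastCases ?_ zpx i
      have : (p (Fin.last P.k)).x = -(lam • ν₀ - Γ) := congrArg State.x hplast
      rw [this, zlam, zΓ]; simp
    have zy : ∀ i, (p i).y = 0 := fun i => by
      refine Fin.cases (norm_eq_zero.1 (by linarith)) (fun j => ?_) i
      show lam • P.h⁻¹ • (P.theta z j).y + π j = 0
      rw [zlam, zπ]; simp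
    have zu : ∀ i, (p i).u = 0 := fun i => by
      refine Fin.cases (norm_eq_zero.1 (by linarith)) (fun j => ?_) i
      show lam • ((ν j).snd.snd.snd.snd.snd.fst + P.h⁻¹ • (P.theta z j).u) = 0
      rw [zlam, zero_smul]
    have za : ∀ i, (p i).a = 0 := fun i => by
      refine Fin.cases (norm_eq_zero.1 (by linarith)) (fun j => ?_) i
      show lam • ((ν j).snd.snd.snd.snd.snd.snd.fst + P.h⁻¹ • (P.theta z j).a) = 0
      rw [zlam, zero_smul]
    have zb : ∀ i, (p i).b = 0 := fun i => by
      refine Fin.cases (norm_eq_zero.1 (by linarith)) (fun j => ?_) i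
      show lam • ((ν j).snd.snd.snd.snd.snd.snd.snd + P.h⁻¹ • (P.theta z j).b) = 0
      rw [zlam, zero_smul]
    -- With all adjoint data zero, the Euler–Lagrange vector is zero, and it is a nonzero multiple
    -- of `η j`.
    have zη : ∀ j, η j = 0 := fun j => by
      have := hnormal j
      simp only [zx, zy, zu, za, zb, zlam, zπ, smul_zero, zero_smul, map_zero, sub_zero,
        add_zero] at this
      exact (smul_eq_zero.1 this.symm).resolve_left (inv_ne_zero hh.ne')
    have zζ : ζ = 0 := by
      have : ζ = ((p 0).x ⊠ (p 0).y ⊠ (p 0).u ⊠ (p 0).a ⊠ (p 0).b) := rfl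
      rw [this, zx, zy, zu, za, zb]
      rfl
    simp [zlam, zα, zπ, zη, zζ] at hsum
  · have : (p (Fin.last P.k)).x = -(lam • ν₀ - Γ) := congrArg State.x hplast
    show -(p (Fin.last P.k)).x = lam • ν₀ - Γ
    rw [this, neg_neg]
  · have : (p (Fin.last P.k)).u = -Γ := congrArg State.u hplast
    show -(p (Fin.last P.k)).u = Γ
    rw [this, neg_neg]
  · exact (congrArg State.y hplast).trans neg_zero
  · exact (congrArg State.a hplast).trans neg_zero
  · exact (congrArg State.b hplast).trans neg_zero
  · show lam • P.h⁻¹ • (P.theta z j).y + π j = lam • P.h⁻¹ • (P.theta z j).y + P.h⁻¹ • P.h • π j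
    rw [inv_smul_smul₀ hh.ne']
  · exact (hnormal j).symm ▸ normalCone_smul_mem (inv_nonneg.2 hh.le) (hη j)
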